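/- Let $n,m\ge 0$ be integers. For $p\ge 0$ let $\mathcal E'(S^p)$ be the space of compactly supported (real- or complex-valued) distributional symmetric $p$-tensor fields on $\mathbb R^n$, i.e. families $f=(f_{i_1\dots i_p})$, $1\le i_1,\dots,i_p\le n$, of elements of $\mathcal E'(\mathbb R^n)$ that are symmetric in the indices. For an integer $k\ge 0$ and $f\in\mathcal E'(S^p)$ the momentum ray transform $I^kf\in\mathcal D'(\mathbb R^n\times(\mathbb R^n\setminus\{0\}))$ is defined by $$\langle I^kf,\psi\rangle=\sum_{i_1,\dots,i_p=1}^n\Big\langle f_{i_1\dots i_p},\ \int_{\mathbb R^n}\int_{\mathbb R}t^k\,\xi^{i_1}\cdots\xi^{i_p}\,\psi(x-t\xi,\xi)\,dt\,d\xi\Big\rangle,\qquad \psi\in C_c^\infty(\mathbb R^n\times(\mathbb R^n\setminus\{0\})),$$ and for $F=(f^{(0)},\dots,f^{(m)})\in\bigoplus_{p=0}^m\mathcal E'(S^p)$ put $I^{m,k}F=\sum_{p=0}^mI^kf^{(p)}$. Let $P_r(\xi,\partial_\xi)=\sum_{i_1,\dots,i_r=1}^n\xi^{i_1}\cdots\xi^{i_r}\frac{\partial^r}{\partial\xi^{i_1}\cdots\partial\xi^{i_r}}$,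 and let $\sigma(i_1\dots i_j)$ denote symmetrization, i.e. the arithmetic mean over all permutations of the indices $i_1,\dots,i_j$. Theorem. (a) For every $F=(f^{(0)},\dots,f^{(m)})\in\bigoplus_{p=0}^m\mathcal E'(S^p)$, every $0\le j\le m$ and all indices $i_1,\dots,i_j\in\{1,\dots,n\}$, $$I^0\big(f^{(j)}_{i_1\dots i_j}\big)=\frac{(-1)^{m-j}}{(m-j)!\,j!}\,\sigma(i_1\dots i_j)\,P_{m-j}(\xi,\partial_\xi)\sum_{k=0}^j(-1)^k\binom jk\frac{\partial^j(I^{m,k}F)}{\partial x^{i_1}\cdots\partial x^{i_k}\,\partial\xi^{i_{k+1}}\cdots\partial\xi^{i_j}}$$ in the sense of distributions on $\mathbb R^n\times(\mathbb R^n\setminus\{0\})$, where on the left $I^0$ is applied to the scalar distribution $f^{(j)}_{i_1\dots i_j}\in\mathcal E'(\mathbb R^n)=\mathcal E'(S^0)$. (b) Let $n\ge 2$ and $0\le k<m$. If $I^{m,l}F=0$ for $l=0,1,\dots,k$, then $f^{(j)}=0$ for $j=0,1,\dots,k$. -/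

import Mathlib

open MeasureTheory TopologicalSpace
open scoped Distributions LineDeriv ContDiff

noncomputable section

namespace MomentumRay

/-- The Euclidean space `ℝⁿ`. -/
abbrev Rn (n : ℕ) : Type := EuclideanSpace ℝ (Fin n)

/-- The `i`-th vector of the standard basis of `ℝⁿ`. -/
def stdVec {n : ℕ} (i : Fin n) : Rn n := EuclideanSpace.single i 1

/-- The open set `ℝⁿ × (ℝⁿ ∖ {0})` of pairs `(x, ξ)`. -/
def phaseSpace (n : ℕ) : Opens (Rn n × Rn n) :=
  ⟨{p | p.2 ≠ 0}, isOpen_ne_fun continuous_snd continuous_const⟩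

/-- The space `C^∞(ℝⁿ)` of real-valued smooth functions. -/
def smoothFunctions (n : ℕ) : Submodule ℝ (Rn n → ℝ) where
  carrier := {φ | ContDiff ℝ ∞ φ}
  add_mem' := by
    intro a b (ha : ContDiff ℝ ∞ a) (hb : ContDiff ℝ ∞ b)
    exact ha.add hb
  zero_mem' := (contDiff_const : ContDiff ℝ ∞ fun _ : Rn n => (0 : ℝ))
  smul_mem' := by
    intro c a (ha : ContDiff ℝ ∞ a)
    exact ha.const_smul c

/-- The space `𝓔'(ℝⁿ)` of compactly supported (real or complex) distributions, as the dual of the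
Fréchet space `C^∞(ℝⁿ)`: linear functionals `u` for which there are a compact set `K`, an order `N`
and a constant `C` such that `|⟨u, φ⟩| ≤ C * M` whenever the derivatives of `φ` of order at most
`N` are bounded by `M` on `K`. As for Mathlib's `𝓓'(Ω, 𝕜)`, test functions are real-valued. -/
def compactDistributions (𝕜 : Type*) [RCLike 𝕜] (n : ℕ) :
    Submodule ℝ (smoothFunctions n →ₗ[ℝ] 𝕜) where
  carrier := {u | ∃ K : Set (Rn n), IsCompact K ∧ ∃ (N : ℕ) (C : ℝ),
    ∀ (φ : smoothFunctions n) (M : ℝ), 0 ≤ M →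
      (∀ l ≤ N, ∀ x ∈ K, ‖iteratedFDeriv ℝ l (φ : Rn n → ℝ) x‖ ≤ M) → ‖u φ‖ ≤ C * M}
  add_mem' := by
    rintro u v ⟨K, hK, N, C, h⟩ ⟨K', hK', N', C', h'⟩
    refine ⟨K ∪ K', hK.union hK', max N N', C + C', fun φ M hM hφ => ?_⟩
    have h1 := h φ M hM fun l hl x hx => hφ l (hl.trans (le_max_left _ _)) x (Or.inl hx)
    have h2 := h' φ M hM fun l hl x hx => hφ l (hl.trans (le_max_right _ _)) x (Or.inr hx)
    calc ‖(u + v) φ‖ ≤ ‖u φ‖ + ‖v φ‖ := norm_add_le _ _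
      _ ≤ (C + C') * M := by linarith
  zero_mem' := ⟨∅, isCompact_empty, 0, 0, fun φ M _ _ => by simp⟩
  smul_mem' := by
    rintro c u ⟨K, hK, N, C, h⟩
    refine ⟨K, hK, N, |c| * C, fun φ M hM hφ => ?_⟩
    have h1 := h φ M hM hφ
    calc ‖(c • u) φ‖ = |c| * ‖u φ‖ := by simp [norm_smul]
      _ ≤ |c| * (C * M) := by gcongr
      _ = |c| * C * M := by ring

/-- The space `𝓔'(S^p)` of compactly supported distributional symmetric `p`-tensor fields, given
by their components `f_{i₁…i_p}`, symmetric in the indices. -/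
def symTensors (𝕜 : Type*) [RCLike 𝕜] (n p : ℕ) :
    Submodule ℝ ((Fin p → Fin n) → compactDistributions 𝕜 n) where
  carrier := {f | ∀ (π : Equiv.Perm (Fin p)) (i : Fin p → Fin n), f (i ∘ π) = f i}
  add_mem' := fun ha hb π i => by simp [ha π i, hb π i]
  zero_mem' := fun _ _ => rfl
  smul_mem' := fun c _ h π i => by simp [h π i]

/-- The space `𝓔'(S⁰) ⊕ 𝓔'(S¹) ⊕ ⋯ ⊕ 𝓔'(S^m)`, with elements `F = (f⁽⁰⁾, …, f⁽ᵐ⁾)`. -/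
abbrev TensorSums (𝕜 : Type*) [RCLike 𝕜] (n m : ℕ) : Type _ :=
  (p : Fin (m + 1)) → symTensors 𝕜 n p

/-- The monomial `ξ^{i₁} ⋯ ξ^{i_p}`. -/
def monomial {n p : ℕ} (i : Fin p → Fin n) (ξ : Rn n) : ℝ := ∏ s, ξ (i s)

/-- `x ↦ ∫_{ℝⁿ} ∫_ℝ t^k w(ξ) ψ(x - tξ, ξ) dt dξ`. -/
def backProj {n : ℕ} {F : Type} [NormedAddCommGroup F] [NormedSpace ℝ F]
    (k : ℕ) (w : Rn n → ℝ) (ψ : Rn n × Rn n → F) (x : Rn n) : F :=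
  ∫ ξ : Rn n, ∫ t : ℝ, (t ^ k * w ξ) • ψ (x - t • ξ, ξ)

section Smoothness

variable {n : ℕ} {F : Type} [NormedAddCommGroup F] [NormedSpace ℝ F]

lemma exists_box {K : Set (Rn n × Rn n)} (hK : IsCompact K) (hΩ : K ⊆ phaseSpace n) (R : ℝ) :
    ∃ B : Set (Rn n × ℝ), IsCompact B ∧
      ∀ x : Rn n, ‖x‖ ≤ R → ∀ ξ t, (x - t • ξ, ξ) ∈ K → (ξ, t) ∈ B := by
  have hne : ∀ p ∈ K, p.2 ≠ 0 := fun p hp => hΩ hp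
  have hpos : ∀ p ∈ K, (0 : ℝ) < ‖p.2‖ := fun p hp => norm_pos_iff.2 (hne p hp)
  have hcont : ContinuousOn (fun p : Rn n × Rn n => ‖p.2‖) K := continuous_snd.norm.continuousOn
  obtain ⟨δ, hδ, hδK⟩ := hK.exists_forall_le' hcont hpos
  obtain ⟨M, hM⟩ := hK.isBounded.exists_norm_le
  refine ⟨Metric.closedBall 0 M ×ˢ Metric.closedBall 0 ((R + M) / δ),
    (isCompact_closedBall _ _).prod (isCompact_closedBall _ _), fun x hx ξ t h => ?_⟩
  have h1 := hM _ h
  rw [Prod.norm_mk, max_le_iff] at h1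
  obtain ⟨h3, h2⟩ := h1
  have h4 := hδK _ h
  have h5 : ‖t • ξ‖ ≤ R + M := by
    calc ‖t • ξ‖ = ‖x - (x - t • ξ)‖ := by rw [sub_sub_cancel]
      _ ≤ ‖x‖ + ‖x - t • ξ‖ := norm_sub_le _ _
      _ ≤ R + M := add_le_add hx h3
  rw [norm_smul] at h5
  refine Set.mk_mem_prod (mem_closedBall_zero_iff.2 h2) (mem_closedBall_zero_iff.2 ?_)
  rw [le_div_iff₀ hδ]
  exact (mul_le_mul_of_nonneg_left h4 (norm_nonneg _)).trans h5

lemma integrable_kernel {K : Set (Rn n × Rn n)} (hK : IsCompact K) (hΩ : K ⊆ phaseSpace n)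
    (k : ℕ) {w : Rn n → ℝ} (hw : Continuous w) {ψ : Rn n × Rn n → F} (hψ : Continuous ψ)
    (h0 : ∀ p ∉ K, ψ p = 0) (x : Rn n) :
    Integrable (fun q : Rn n × ℝ => (q.2 ^ k * w q.1) • ψ (x - q.2 • q.1, q.1)) := by
  obtain ⟨B, hB, hBx⟩ := exists_box hK hΩ ‖x‖
  apply Continuous.integrable_of_hasCompactSupport
  · fun_prop
  · refine HasCompactSupport.intro hB fun q hq => ?_
    rw [h0 _ fun h => hq (hBx x le_rfl _ _ h), smul_zero]

lemma backProj_eq {K : Set (Rn n × Rn n)} (hK : IsCompact K) (hΩ : K ⊆ phaseSpace n)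
    (k : ℕ) {w : Rn n → ℝ} (hw : Continuous w) {ψ : Rn n × Rn n → F} (hψ : Continuous ψ)
    (h0 : ∀ p ∉ K, ψ p = 0) (x : Rn n) :
    backProj k w ψ x = ∫ q : Rn n × ℝ, (q.2 ^ k * w q.1) • ψ (x - q.2 • q.1, q.1) := by
  rw [Measure.volume_eq_prod, integral_prod]
  · rfl
  · exact integrable_kernel hK hΩ k hw hψ h0 x

lemma backProj_bound {K : Set (Rn n × Rn n)} (hK : IsCompact K) (hΩ : K ⊆ phaseSpace n)
    (k : ℕ) {w : Rn n → ℝ} (hw : Continuous w) (R : ℝ) :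
    ∃ C : ℝ, 0 ≤ C ∧ ∀ {F : Type} [NormedAddCommGroup F] [NormedSpace ℝ F]
      {ψ : Rn n × Rn n → F}, Continuous ψ → (∀ p ∉ K, ψ p = 0) →
      ∀ M : ℝ, 0 ≤ M → (∀ p, ‖ψ p‖ ≤ M) → ∀ x, ‖x‖ ≤ R → ‖backProj k w ψ x‖ ≤ C * M := by
  obtain ⟨B, hB, hBx⟩ := exists_box hK hΩ R
  obtain ⟨A, hA⟩ := hB.exists_bound_of_continuousOn
    (f := fun q : Rn n × ℝ => q.2 ^ k * w q.1) (by fun_prop)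
  refine ⟨|A| * (volume B).toReal, by positivity, ?_⟩
  intro F _ _ ψ hψ h0 M hM hψM x hx
  rw [backProj_eq hK hΩ k hw hψ h0, ← setIntegral_eq_integral_of_forall_compl_eq_zero (s := B)]
  · calc _ ≤ (|A| * M) * (volume B).toReal := by
          refine norm_setIntegral_le_of_norm_le_const hB.measure_lt_top fun q hq => ?_
          rw [norm_smul]
          exact mul_le_mul ((hA q hq).trans (le_abs_self A)) (hψM _) (norm_nonneg _) (abs_nonneg _)
      _ = _ := by ring
  · intro q hq
    rw [h0 _ fun h => hq (hBx x hx _ _ h), smul_zero]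

/-- The partial derivative of `ψ(x, ξ)` with respect to `x`. -/
def xDeriv (ψ : Rn n × Rn n → F) (p : Rn n × Rn n) : Rn n →L[ℝ] F :=
  (fderiv ℝ ψ p).comp (ContinuousLinearMap.inl ℝ (Rn n) (Rn n))

lemma xDeriv_contDiff {ψ : Rn n × Rn n → F} (hψ : ContDiff ℝ ∞ ψ) : ContDiff ℝ ∞ (xDeriv ψ) :=
  (hψ.fderiv_right (m := ∞) (by simp)).clm_comp contDiff_const

lemma xDeriv_zero {K : Set (Rn n × Rn n)} (hK : IsCompact K) {ψ : Rn n × Rn n → F}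
    (h0 : ∀ p ∉ K, ψ p = 0) : ∀ p ∉ K, xDeriv ψ p = 0 := by
  intro p hp
  have : ψ =ᶠ[nhds p] fun _ => 0 := by
    filter_upwards [hK.isClosed.isOpen_compl.mem_nhds hp] with q hq using h0 q hq
  rw [xDeriv, this.fderiv_eq]
  simp

lemma xDeriv_bound {ψ : Rn n × Rn n → F} (hψ : ContDiff ℝ ∞ ψ) {N : ℕ} {M : ℝ}
    (h : ∀ p, ‖iteratedFDeriv ℝ (N + 1) ψ p‖ ≤ M) (p : Rn n × Rn n) :
    ‖iteratedFDeriv ℝ N (xDeriv ψ) p‖ ≤ M := by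
  set T : ((Rn n × Rn n) →L[ℝ] F) →L[ℝ] (Rn n →L[ℝ] F) :=
    (ContinuousLinearMap.inl ℝ (Rn n) (Rn n)).precomp F
  have hT : ‖T‖ ≤ 1 := by
    refine ContinuousLinearMap.opNorm_le_bound _ zero_le_one fun g => ?_
    calc ‖T g‖ ≤ ‖g‖ * ‖ContinuousLinearMap.inl ℝ (Rn n) (Rn n)‖ :=
          ContinuousLinearMap.opNorm_comp_le _ _
      _ ≤ ‖g‖ * 1 := by gcongr; exact ContinuousLinearMap.norm_inl_le_one _ _ _
      _ = 1 * ‖g‖ := by ring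
  have hd : ContDiff ℝ ∞ (fderiv ℝ ψ) := hψ.fderiv_right (m := ∞) (by simp)
  have e : xDeriv ψ = T ∘ fderiv ℝ ψ := rfl
  calc ‖iteratedFDeriv ℝ N (xDeriv ψ) p‖
      = ‖T.compContinuousMultilinearMap (iteratedFDeriv ℝ N (fderiv ℝ ψ) p)‖ := by
        rw [e, T.iteratedFDeriv_comp_left hd.contDiffAt (by exact_mod_cast le_top)]
    _ ≤ ‖T‖ * ‖iteratedFDeriv ℝ N (fderiv ℝ ψ) p‖ := T.norm_compContinuousMultilinearMap_le _
    _ ≤ 1 * M := by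
        rw [norm_iteratedFDeriv_fderiv]
        exact mul_le_mul hT (h p) (norm_nonneg _) zero_le_one
    _ = M := one_mul M

lemma backProj_hasFDerivAt {K : Set (Rn n × Rn n)} (hK : IsCompact K) (hΩ : K ⊆ phaseSpace n)
    (k : ℕ) {w : Rn n → ℝ} (hw : Continuous w) {ψ : Rn n × Rn n → F} (hψ : ContDiff ℝ ∞ ψ)
    (h0 : ∀ p ∉ K, ψ p = 0) (x : Rn n) :
    HasFDerivAt (backProj k w ψ) (backProj k w (xDeriv ψ) x) x := by
  have hψ' := (xDeriv_contDiff hψ).continuous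
  have h0' := xDeriv_zero hK h0
  rw [backProj_eq hK hΩ k hw hψ' h0', funext (backProj_eq hK hΩ k hw hψ.continuous h0)]
  obtain ⟨B, hB, hBx⟩ := exists_box hK hΩ (‖x‖ + 1)
  obtain ⟨A, hA⟩ := hB.exists_bound_of_continuousOn
    (f := fun q : Rn n × ℝ => q.2 ^ k * w q.1) (by fun_prop)
  obtain ⟨D, hD⟩ := hψ'.bounded_above_of_compact_support (HasCompactSupport.intro hK h0')
  refine hasFDerivAt_integral_of_dominated_of_fderiv_le (s := Metric.ball x 1)
    (bound := B.indicator fun _ => |A| * D)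
    (F' := fun y q => (q.2 ^ k * w q.1) • xDeriv ψ (y - q.2 • q.1, q.1))
    (Metric.ball_mem_nhds x one_pos) ?_ ?_ ?_ ?_ ?_ ?_
  · exact .of_forall fun y => (integrable_kernel hK hΩ k hw hψ.continuous h0 y).1
  · exact integrable_kernel hK hΩ k hw hψ.continuous h0 x
  · exact (integrable_kernel hK hΩ k hw hψ' h0' x).1
  · refine .of_forall fun q y hy => ?_
    have hy' : ‖y‖ ≤ ‖x‖ + 1 := by
      have := norm_le_norm_add_norm_sub' y x
      rw [mem_ball_iff_norm] at hy
      linarith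
    by_cases hq : q ∈ B
    · rw [Set.indicator_of_mem hq, norm_smul]
      exact mul_le_mul ((hA q hq).trans (le_abs_self A)) (hD _) (norm_nonneg _) (abs_nonneg _)
    · rw [Set.indicator_of_notMem hq, h0' _ fun h => hq (hBx y hy' _ _ h), smul_zero, norm_zero]
  · rw [integrable_indicator_iff hB.measurableSet]
    exact integrableOn_const hB.measure_lt_top.ne
  · refine .of_forall fun q y _ => ?_
    have h1 : HasFDerivAt ψ (fderiv ℝ ψ (y - q.2 • q.1, q.1)) (y - q.2 • q.1, q.1) :=
      (hψ.differentiable (by simp) _).hasFDerivAt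
    have h2 : HasFDerivAt (fun y : Rn n => (y - q.2 • q.1, q.1))
        (ContinuousLinearMap.inl ℝ (Rn n) (Rn n)) y :=
      ((hasFDerivAt_id y).sub_const _).prodMk (hasFDerivAt_const q.1 y)
    exact (h1.comp y h2).const_smul _

lemma backProj_contDiff_nat {K : Set (Rn n × Rn n)} (hK : IsCompact K) (hΩ : K ⊆ phaseSpace n)
    (k : ℕ) {w : Rn n → ℝ} (hw : Continuous w) (N : ℕ) :
    ∀ {F : Type} [NormedAddCommGroup F] [NormedSpace ℝ F] {ψ : Rn n × Rn n → F},
      ContDiff ℝ ∞ ψ → (∀ p ∉ K, ψ p = 0) → ContDiff ℝ N (backProj k w ψ) := by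
  induction N with
  | zero =>
    intro F _ _ ψ hψ h0
    exact contDiff_zero.2 (continuous_iff_continuousAt.2 fun x =>
      (backProj_hasFDerivAt hK hΩ k hw hψ h0 x).continuousAt)
  | succ N ih =>
    intro F _ _ ψ hψ h0
    exact contDiff_succ_iff_hasFDerivAt.2
      ⟨_, ih (xDeriv_contDiff hψ) (xDeriv_zero hK h0), backProj_hasFDerivAt hK hΩ k hw hψ h0⟩

lemma backProj_iteratedFDeriv_bound {K : Set (Rn n × Rn n)} (hK : IsCompact K)
    (hΩ : K ⊆ phaseSpace n) (k : ℕ) {w : Rn n → ℝ} (hw : Continuous w) (R : ℝ) :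
    ∃ C : ℝ, 0 ≤ C ∧ ∀ (N : ℕ) {F : Type} [NormedAddCommGroup F] [NormedSpace ℝ F]
      {ψ : Rn n × Rn n → F}, ContDiff ℝ ∞ ψ → (∀ p ∉ K, ψ p = 0) →
      ∀ M : ℝ, 0 ≤ M → (∀ p, ‖iteratedFDeriv ℝ N ψ p‖ ≤ M) →
      ∀ x, ‖x‖ ≤ R → ‖iteratedFDeriv ℝ N (backProj k w ψ) x‖ ≤ C * M := by
  obtain ⟨C, hC, h⟩ := backProj_bound hK hΩ k hw R
  refine ⟨C, hC, fun N => ?_⟩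
  induction N with
  | zero =>
    intro F _ _ ψ hψ h0 M hM hψM x hx
    simp only [norm_iteratedFDeriv_zero] at hψM ⊢
    exact h hψ.continuous h0 M hM hψM x hx
  | succ N ih =>
    intro F _ _ ψ hψ h0 M hM hψM x hx
    rw [← norm_iteratedFDeriv_fderiv,
      funext fun y => (backProj_hasFDerivAt hK hΩ k hw hψ h0 y).fderiv]
    exact ih (xDeriv_contDiff hψ) (xDeriv_zero hK h0) M hM (xDeriv_bound hψ hψM) x hx

lemma monomial_contDiff {p : ℕ} (i : Fin p → Fin n) : ContDiff ℝ ∞ (monomial i) := by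
  unfold monomial
  fun_prop

end Smoothness

/-- The `i`-component `[(I^k)^* ψ]_{i₁…i_p}(x) = ∫_{ℝⁿ} ∫_ℝ t^k ξ^{i₁}⋯ξ^{i_p} ψ(x - tξ, ξ) dt dξ`
of the adjoint of the `k`-th momentum ray transform on `p`-tensors, for
`ψ ∈ C_c^∞(ℝⁿ × (ℝⁿ ∖ {0}))`. It is a smooth function of `x`. -/
def adjoint {n p : ℕ} (k : ℕ) (i : Fin p → Fin n) (ψ : 𝓓(phaseSpace n, ℝ)) : smoothFunctions n :=
  ⟨fun x => ∫ ξ : Rn n, ∫ t : ℝ, t ^ k * monomial i ξ * ψ (x - t • ξ, ξ),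
    contDiff_infty.2 fun N => backProj_contDiff_nat ψ.hasCompactSupport ψ.tsupport_subset k
      (monomial_contDiff i).continuous N ψ.contDiff fun _ => image_eq_zero_of_notMem_tsupport⟩

section Continuity

variable {𝕜 : Type*} [RCLike 𝕜] {n p : ℕ}

lemma adjoint_coe (k : ℕ) (i : Fin p → Fin n) (ψ : 𝓓(phaseSpace n, ℝ)) :
    (adjoint k i ψ : Rn n → ℝ) = backProj k (monomial i) ψ := rfl

lemma adjoint_add (k : ℕ) (i : Fin p → Fin n) (ψ χ : 𝓓(phaseSpace n, ℝ)) :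
    adjoint k i (ψ + χ) = adjoint k i ψ + adjoint k i χ := by
  have hw := (monomial_contDiff i).continuous
  have h (ψ : 𝓓(phaseSpace n, ℝ)) (x : Rn n) := backProj_eq ψ.hasCompactSupport ψ.tsupport_subset k
    hw ψ.continuous (fun _ => image_eq_zero_of_notMem_tsupport) x
  have h' (ψ : 𝓓(phaseSpace n, ℝ)) (x : Rn n) := integrable_kernel ψ.hasCompactSupport
    ψ.tsupport_subset k hw ψ.continuous (fun _ => image_eq_zero_of_notMem_tsupport) x
  ext x
  change backProj k (monomial i) (ψ + χ : 𝓓(phaseSpace n, ℝ)) x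
    = backProj k (monomial i) ψ x + backProj k (monomial i) χ x
  rw [h, h, h, ← integral_add (h' ψ x) (h' χ x)]
  simp [mul_add]

lemma adjoint_smul (k : ℕ) (i : Fin p → Fin n) (c : ℝ) (ψ : 𝓓(phaseSpace n, ℝ)) :
    adjoint k i (c • ψ) = c • adjoint k i ψ := by
  ext x
  change backProj k (monomial i) (c • ψ : 𝓓(phaseSpace n, ℝ)) x = c • backProj k (monomial i) ψ x
  simp only [backProj]
  rw [← integral_smul]
  congr 1; ext ξ
  rw [← integral_smul]
  congr 1; ext t
  change t ^ k * monomial i ξ * (c * ψ (x - t • ξ, ξ))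
    = c * (t ^ k * monomial i ξ * ψ (x - t • ξ, ξ))
  ring

lemma continuous_adjoint (k : ℕ) (i : Fin p → Fin n) (u : compactDistributions 𝕜 n)
    (K : Compacts (Rn n × Rn n)) (hK : (K : Set (Rn n × Rn n)) ⊆ phaseSpace n) :
    Continuous fun ψ : 𝓓_{K}(Rn n × Rn n, ℝ) =>
      u.1 (adjoint k i (TestFunction.ofSupportedIn hK ψ)) := by
  obtain ⟨L, hL, N, C, hC⟩ := u.2
  obtain ⟨R, hR⟩ := hL.isBounded.exists_norm_le
  obtain ⟨C', hC', h⟩ := backProj_iteratedFDeriv_bound K.isCompact hK k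
    (monomial_contDiff i).continuous R
  refine (ContDiffMapSupportedIn.mkCLMtoNormedSpace ℝ
    (fun ψ : 𝓓_{K}(Rn n × Rn n, ℝ) => u.1 (adjoint k i (TestFunction.ofSupportedIn hK ψ)))
    ?_ ?_ ⟨Finset.Iic N, |C| * C', by positivity, ?_⟩).continuous
  · intro ψ χ
    rw [← map_add, ← adjoint_add]; rfl
  · intro c ψ
    rw [← map_smul, ← adjoint_smul]; rfl
  · intro ψ
    set S := (Finset.Iic N).sup (fun l => N[ℝ]_{K, l}) ψ
    have hS : 0 ≤ S := apply_nonneg _ _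
    calc _ ≤ C * (C' * S) := by
          refine hC _ _ (by positivity) fun l hl x hx => ?_
          refine h l ψ.contDiff (fun q hq => ψ.zero_on_compl hq) S hS (fun q => ?_) x (hR x hx)
          exact (ContDiffMapSupportedIn.norm_iteratedFDeriv_apply_le_seminorm_top ℝ).trans
            (Seminorm.le_finset_sup_apply (Finset.mem_Iic.2 hl))
      _ ≤ |C| * (C' * S) := by gcongr; exact le_abs_self C
      _ = |C| * C' * S := by ring

end Continuity

section Transforms

variable {𝕜 : Type*} [RCLike 𝕜] {n : ℕ}

/-- The distribution `ψ ↦ ⟨u, [(I^k)^* ψ]_{i₁…i_p}⟩` on `ℝⁿ × (ℝⁿ ∖ {0})`. -/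
def componentTransform {p : ℕ} (k : ℕ) (i : Fin p → Fin n) (u : compactDistributions 𝕜 n) :
    𝓓'(phaseSpace n, 𝕜) :=
  TestFunction.mkCLM ℝ (fun ψ => u.1 (adjoint k i ψ))
    (fun ψ χ => by rw [adjoint_add, map_add]) (fun c ψ => by rw [adjoint_smul, map_smul])
    (fun K hK => continuous_adjoint k i u K hK)

/-- The `k`-th momentum ray transform `I^k f ∈ 𝓓'(ℝⁿ × (ℝⁿ ∖ {0}))` of `f ∈ 𝓔'(S^p)`:
`⟨I^k f, ψ⟩ = ⟨f, (I^k)^* ψ⟩ = ∑_{i₁…i_p} ⟨f_{i₁…i_p}, [(I^k)^* ψ]_{i₁…i_p}⟩`. -/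
def momentRay {p : ℕ} (k : ℕ) (f : symTensors 𝕜 n p) : 𝓓'(phaseSpace n, 𝕜) :=
  ∑ i : Fin p → Fin n, componentTransform k i (f.1 i)

/-- The generalized momentum ray transform `I^{m,k} F = ∑_{p ≤ m} I^k f⁽ᵖ⁾`. -/
def genMomentRay {m : ℕ} (k : ℕ) (F : TensorSums 𝕜 n m) : 𝓓'(phaseSpace n, 𝕜) :=
  ∑ p : Fin (m + 1), momentRay k (F p)

/-- A compactly supported scalar distribution as a tensor field of rank `0`. -/
def scalarTensor (u : compactDistributions 𝕜 n) : symTensors 𝕜 n 0 :=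
  ⟨fun _ => u, fun _ _ => rfl⟩

/-- Multiplication of test functions by a smooth function. -/
def mulTest (g : Rn n × Rn n → ℝ) (hg : ContDiff ℝ ∞ g) :
    𝓓(phaseSpace n, ℝ) →L[ℝ] 𝓓(phaseSpace n, ℝ) :=
  TestFunction.limitCLM ℝ
    (fun ψ => ⟨fun q => ψ q * g q, ψ.contDiff.mul hg, ψ.hasCompactSupport.mul_right,
      (tsupport_mul_subset_left).trans ψ.tsupport_subset⟩)
    (fun _ hK => TestFunction.ofSupportedInCLM ℝ hK ∘L
      ContDiffMapSupportedIn.bilinLeftCLM (ContinuousLinearMap.mul ℝ ℝ) hg)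
    (fun _ _ _ => rfl)

/-- The product `g T` of a distribution with a smooth function, `⟨g T, ψ⟩ = ⟨T, g ψ⟩`. -/
def smoothMul (g : Rn n × Rn n → ℝ) (hg : ContDiff ℝ ∞ g) (T : 𝓓'(phaseSpace n, 𝕜)) :
    𝓓'(phaseSpace n, 𝕜) :=
  (mulTest g hg).precompCompactConvergenceCLM 𝕜 T

/-- The operator `P_r(ξ, ∂_ξ) = ξ^{i₁} ⋯ ξ^{i_r} ∂^r / ∂ξ^{i₁} ⋯ ∂ξ^{i_r}` on distributions, with
summation over `i₁, …, i_r`. -/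
def eulerOp (r : ℕ) (T : 𝓓'(phaseSpace n, 𝕜)) : 𝓓'(phaseSpace n, 𝕜) :=
  ∑ i : Fin r → Fin n, smoothMul (fun q => monomial i q.2)
    ((monomial_contDiff i).comp contDiff_snd) (∂^{fun s => ((0 : Rn n), stdVec (i s))} T)

/-- The mixed derivative `∂^j T / ∂x^{i₁} ⋯ ∂x^{i_k} ∂ξ^{i_{k+1}} ⋯ ∂ξ^{i_j}`. -/
def mixedDeriv {j : ℕ} (k : ℕ) (i : Fin j → Fin n) (T : 𝓓'(phaseSpace n, 𝕜)) :
    𝓓'(phaseSpace n, 𝕜) :=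
  ∂^{fun s : Fin j =>
    if (s : ℕ) < k then (stdVec (i s), (0 : Rn n)) else ((0 : Rn n), stdVec (i s))} T

/-- The symmetrization `σ(i₁ … i_j)`: the mean over all permutations of the indices. -/
def symmetrize {j : ℕ} (A : (Fin j → Fin n) → 𝓓'(phaseSpace n, 𝕜)) (i : Fin j → Fin n) :
    𝓓'(phaseSpace n, 𝕜) :=
  ((j.factorial : ℝ)⁻¹) • ∑ π : Equiv.Perm (Fin j), A (i ∘ π)

end Transforms

end MomentumRay

end

open MomentumRay

/-! For a polynomial weight `w`, put T_k(w) = `weightTransform k w u`. Two integrations by parts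
govern everything. In ξ: ∂_{ξ^a} T_k(w) - ∂_{x^a} T_{k+1}(w) = T_k(∂_a w)
(`weightTransform_pderiv`). In t: ∑ ξ^a ∂_{x^a} T_{k+1}(w) = -(k+1) T_k(w)
(`sum_xiMul_lineDerivOp_weightTransform`).

Part (a). Iterating the first identity and symmetrizing turns the alternating sum of mixed
derivatives into T_0(∂^j w) (`sum_perm_altDeriv_weightTransform`). Take for `w` the monomials of
degree p that make up F. If p < j, then ∂^j w = 0. If p = j, the monomials add up to j! times the
ray transform of the wanted component, by symmetry of the tensor. If p > j, a weight of degree d = p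
- j between 1 and m - j remains. By both identities and Euler's theorem, T_0 of a weight of degree d
is homogeneous of degree d - 1 in ξ (`eulerField_weightTransform`), so P_r acts on it as the scalar
(d-1)(d-2)⋯(d-r) (`eulerOp_eq_smul`). For r = m - j this kills every p > j and gives (-1)^r r! at p
= j.

Part (b). Formula (a) for index j involves only the moments 0, …, j, so every component of degree at
most k has vanishing ray transform, and injectivity of I^0 for n ≥ 2 remains. Given η, choose ξ ≠ 0
orthogonal to it; the plane wave of frequency η is constant along ξ. Since a single direction is not
a test function, the wave is put in a family e^{-2πi L(ζ, x)} with L alternating, each member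
constant along its own ζ. Weighted averages of this family over ζ agree, on a ball outside which `u`
is not sensitive, with adjoint ray transforms, so `u` kills the averages and by continuity each wave
(`apply_waveRe_eq_zero`). Fourier inversion then gives `u = 0` (`eq_zero_of_planeWave`). -/

noncomputable section

namespace MomentumRay

/-! ### Commuting derivatives of distributions -/

section DistributionAlgebra

variable {E : Type*} [NormedAddCommGroup E] [NormedSpace ℝ E] {Ω : Opens E}

lemma testFunction_lineDerivOp_apply (v : E) (ψ : 𝓓(Ω, ℝ)) (q : E) :
    (∂_{v} ψ : 𝓓(Ω, ℝ)) q = fderiv ℝ ψ q v := by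
  change (TestFunction.lineDerivCLM ℝ v ψ : 𝓓(Ω, ℝ)) q = _
  rw [TestFunction.lineDerivCLM_eq_fderivCLM, TestFunction.fderivCLM_apply_of_le _ (by simp)]

lemma testFunction_lineDerivOp_comm (v w : E) (ψ : 𝓓(Ω, ℝ)) :
    ∂_{v} (∂_{w} ψ) = ∂_{w} (∂_{v} ψ) := by
  have hd : Differentiable ℝ (fderiv ℝ ψ) :=
    (ψ.contDiff.fderiv_right (m := ∞) (by simp)).differentiable (by simp)
  have key (v w : E) (q : E) :
      (∂_{v} (∂_{w} ψ) : 𝓓(Ω, ℝ)) q = fderiv ℝ (fderiv ℝ ψ) q v w := by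
    rw [testFunction_lineDerivOp_apply, funext (testFunction_lineDerivOp_apply w ψ),
      fderiv_clm_apply (hd q) (differentiableAt_const w)]
    simp
  ext q
  rw [key, key]
  exact (ψ.contDiff.contDiffAt.isSymmSndFDerivAt (by
    rw [minSmoothness_of_isRCLikeNormedField]
    exact WithTop.coe_le_coe.2 (le_top : (2 : ℕ∞) ≤ ⊤))).eq v w

variable {𝕜 : Type*} [RCLike 𝕜]

lemma lineDerivOp_comm (v w : E) (T : 𝓓'(Ω, 𝕜)) : ∂_{v} (∂_{w} T) = ∂_{w} (∂_{v} T) := by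
  ext ψ
  simp only [Distribution.lineDerivOp_apply_apply, LineDeriv.lineDerivOp_neg, neg_neg]
  rw [testFunction_lineDerivOp_comm]

lemma lineDerivOp_iterated_comm (v : E) {r : ℕ} (m : Fin r → E) (T : 𝓓'(Ω, 𝕜)) :
    ∂_{v} (∂^{m} T) = ∂^{m} (∂_{v} T) := by
  induction r with
  | zero => rfl
  | succ r ih =>
    rw [LineDeriv.iteratedLineDerivOp_succ_left, LineDeriv.iteratedLineDerivOp_succ_left,
      lineDerivOp_comm, ih]

end DistributionAlgebra

/-! ### Homogeneity in ξ and the operators P_r -/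

section Euler

variable {𝕜 : Type*} [RCLike 𝕜] {n : ℕ}

lemma contDiff_sndCoord (a : Fin n) : ContDiff ℝ ∞ fun q : Rn n × Rn n => q.2 a := by
  fun_prop

/-- Multiplication of a distribution by the coordinate `ξ^a`. -/
def xiMul (a : Fin n) (T : 𝓓'(phaseSpace n, 𝕜)) : 𝓓'(phaseSpace n, 𝕜) :=
  smoothMul (fun q => q.2 a) (contDiff_sndCoord a) T

lemma smoothMul_apply (g : Rn n × Rn n → ℝ) (hg : ContDiff ℝ ∞ g) (T : 𝓓'(phaseSpace n, 𝕜))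
    (ψ : 𝓓(phaseSpace n, ℝ)) : smoothMul g hg T ψ = T (mulTest g hg ψ) := rfl

lemma mulTest_apply (g : Rn n × Rn n → ℝ) (hg : ContDiff ℝ ∞ g) (ψ : 𝓓(phaseSpace n, ℝ))
    (q : Rn n × Rn n) : mulTest g hg ψ q = ψ q * g q := rfl

lemma smoothMul_smul (g : Rn n × Rn n → ℝ) (hg : ContDiff ℝ ∞ g) (c : ℝ)
    (T : 𝓓'(phaseSpace n, 𝕜)) : smoothMul g hg (c • T) = c • smoothMul g hg T := rfl

lemma smoothMul_add (g : Rn n × Rn n → ℝ) (hg : ContDiff ℝ ∞ g)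
    (T S : 𝓓'(phaseSpace n, 𝕜)) : smoothMul g hg (T + S) = smoothMul g hg T + smoothMul g hg S := rfl

lemma smoothMul_sum {ι : Type*} (s : Finset ι) (g : Rn n × Rn n → ℝ) (hg : ContDiff ℝ ∞ g)
    (T : ι → 𝓓'(phaseSpace n, 𝕜)) :
    smoothMul g hg (∑ a ∈ s, T a) = ∑ a ∈ s, smoothMul g hg (T a) :=
  map_sum ((mulTest g hg).precompCompactConvergenceCLM 𝕜) T s

/-- Leibniz' rule for the product of a distribution with a coordinate `ξ^a`. -/
lemma lineDerivOp_xiMul (a b : Fin n) (T : 𝓓'(phaseSpace n, 𝕜)) :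
    ∂_{((0 : Rn n), stdVec b)} (xiMul a T) =
      xiMul a (∂_{((0 : Rn n), stdVec b)} T) + if a = b then T else 0 := by
  have hψ (ψ : 𝓓(phaseSpace n, ℝ)) :
      mulTest (fun q => q.2 a) (contDiff_sndCoord a) (∂_{((0 : Rn n), stdVec b)} ψ) =
        ∂_{((0 : Rn n), stdVec b)} (mulTest (fun q => q.2 a) (contDiff_sndCoord a) ψ)
          - if a = b then ψ else 0 := by
    ext q
    have h1 : HasFDerivAt (fun q : Rn n × Rn n => q.2 a)
        ((EuclideanSpace.proj a : Rn n →L[ℝ] ℝ).comp (ContinuousLinearMap.snd ℝ (Rn n) (Rn n))) q :=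
      ((EuclideanSpace.proj a : Rn n →L[ℝ] ℝ).comp
        (ContinuousLinearMap.snd ℝ (Rn n) (Rn n))).hasFDerivAt
    have h2 := ((ψ.contDiff.differentiable (by simp) q).hasFDerivAt.mul h1).fderiv
    have h3 : (mulTest (fun q => q.2 a) (contDiff_sndCoord a) ψ : Rn n × Rn n → ℝ)
      = (ψ : Rn n × Rn n → ℝ) * fun q => q.2 a := rfl
    rw [mulTest_apply, sub_apply, testFunction_lineDerivOp_apply,
      testFunction_lineDerivOp_apply, h3, h2]
    by_cases hab : a = b
    · subst hab
      simp [stdVec]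
      ring
    · simp [stdVec, hab]
      ring
  ext ψ
  rw [add_apply, xiMul, xiMul, smoothMul_apply, Distribution.lineDerivOp_apply_apply,
    Distribution.lineDerivOp_apply_apply, smoothMul_apply, map_neg, map_neg, map_neg, hψ, map_sub]
  split_ifs
  · rw [neg_sub, sub_eq_neg_add]
  · simp

/-- The Euler operator `∑ ξ^a ∂/∂ξ^a`. -/
def eulerField (T : 𝓓'(phaseSpace n, 𝕜)) : 𝓓'(phaseSpace n, 𝕜) :=
  ∑ a : Fin n, xiMul a (∂_{((0 : Rn n), stdVec a)} T)

/-- By Leibniz' rule the commutator of ∂/∂ξ^b with the Euler field is ∂/∂ξ^b, so each ξ-derivative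
lowers the degree of homogeneity by one. -/
lemma eulerField_lineDerivOp (b : Fin n) (T : 𝓓'(phaseSpace n, 𝕜)) :
    eulerField (∂_{((0 : Rn n), stdVec b)} T) =
      ∂_{((0 : Rn n), stdVec b)} (eulerField T) - ∂_{((0 : Rn n), stdVec b)} T := by
  simp only [eulerField, LineDeriv.lineDerivOp_sum, lineDerivOp_xiMul, Finset.sum_add_distrib]
  simp [lineDerivOp_comm (_, stdVec b) ((0 : Rn n), _)]

lemma eulerField_iterated {d : ℝ} {T : 𝓓'(phaseSpace n, 𝕜)} (hT : eulerField T = d • T)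
    {r : ℕ} (i : Fin r → Fin n) :
    eulerField (∂^{fun s => ((0 : Rn n), stdVec (i s))} T) =
      (d - r) • ∂^{fun s => ((0 : Rn n), stdVec (i s))} T := by
  induction r with
  | zero => simpa using hT
  | succ r ih =>
    have := ih (Fin.tail i)
    rw [LineDeriv.iteratedLineDerivOp_succ_left, eulerField_lineDerivOp]
    change ∂_{_} (eulerField (∂^{fun s => ((0 : Rn n), stdVec (Fin.tail i s))} T)) -
      ∂_{_} (∂^{fun s => ((0 : Rn n), stdVec (Fin.tail i s))} T) =
      _ • ∂_{_} (∂^{fun s => ((0 : Rn n), stdVec (Fin.tail i s))} T)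
    rw [this, LineDeriv.lineDerivOp_smul]
    push_cast
    module

/-- Splitting off the index of the outermost derivative, together with its factor ξ^a, leaves the
Euler field acting on an r-th derivative of `T`, which is homogeneous of degree d - r. -/
lemma eulerOp_succ {d : ℝ} {T : 𝓓'(phaseSpace n, 𝕜)} (hT : eulerField T = d • T) (r : ℕ) :
    eulerOp (r + 1) T = (d - r) • eulerOp r T := by
  have h (i : Fin r → Fin n) : smoothMul (fun q => monomial i q.2)
      ((monomial_contDiff i).comp contDiff_snd)
      (eulerField (∂^{fun s => ((0 : Rn n), stdVec (i s))} T)) =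
      ∑ a, smoothMul (fun q => monomial (Fin.cons a i : Fin (r + 1) → Fin n) q.2)
        ((monomial_contDiff _).comp contDiff_snd)
        (∂^{fun s => ((0 : Rn n), stdVec ((Fin.cons a i : Fin (r + 1) → Fin n) s))} T) := by
    rw [eulerField, smoothMul_sum]
    refine Finset.sum_congr rfl fun a _ => ?_
    ext ψ
    rw [xiMul, smoothMul_apply, smoothMul_apply, smoothMul_apply,
      LineDeriv.iteratedLineDerivOp_succ_left]
    congr 1
    ext q
    simp only [mulTest_apply, monomial, Fin.prod_univ_succ, Fin.cons_zero, Fin.cons_succ]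
    ring
  rw [eulerOp, ← (Fin.consEquiv fun _ => Fin n).sum_comp, Fintype.sum_prod_type_right]
  rw [eulerOp, Finset.smul_sum]
  refine Finset.sum_congr rfl fun i _ => ?_
  rw [← smoothMul_smul, ← eulerField_iterated hT, h]
  rfl

/-- The falling factorial vanishes for d = 0, …, r - 1 but not for d = -1; this is how P_r isolates
one tensor degree in the reconstruction. -/
lemma eulerOp_eq_smul {d : ℝ} {T : 𝓓'(phaseSpace n, 𝕜)} (hT : eulerField T = d • T) (r : ℕ) :
    eulerOp r T = (∏ s ∈ Finset.range r, (d - s)) • T := by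
  induction r with
  | zero =>
    ext ψ
    simp only [eulerOp, Finset.univ_unique, Finset.sum_singleton, smoothMul_apply]
    simp only [LineDeriv.iteratedLineDerivOp_fin_zero, Finset.range_zero, Finset.prod_empty,
      one_smul]
    congr 1
    ext q
    simp [mulTest_apply, monomial]
  | succ r ih => rw [eulerOp_succ hT, ih, smul_smul, Finset.prod_range_succ, mul_comm]

lemma eulerOp_sum {ι : Type*} (s : Finset ι) (r : ℕ) (T : ι → 𝓓'(phaseSpace n, 𝕜)) :
    eulerOp r (∑ a ∈ s, T a) = ∑ a ∈ s, eulerOp r (T a) := by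
  simp only [eulerOp, LineDeriv.iteratedLineDerivOp_sum, smoothMul_sum]
  exact Finset.sum_comm

lemma eulerOp_smul (r : ℕ) (c : ℝ) (T : 𝓓'(phaseSpace n, 𝕜)) :
    eulerOp r (c • T) = c • eulerOp r T := by
  simp only [eulerOp, LineDeriv.iteratedLineDerivOp_smul, smoothMul_smul, Finset.smul_sum]

end Euler

/-! ### Polynomials as functions of ξ -/

section PolynomialWeights

variable {n : ℕ}

/-- The function on `ℝⁿ` defined by a polynomial. -/
def polyFun (w : MvPolynomial (Fin n) ℝ) (ξ : Rn n) : ℝ := MvPolynomial.eval ξ.ofLp w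

lemma polyFun_add (w v : MvPolynomial (Fin n) ℝ) (ξ : Rn n) :
    polyFun (w + v) ξ = polyFun w ξ + polyFun v ξ := map_add _ _ _

lemma polyFun_mul (w v : MvPolynomial (Fin n) ℝ) (ξ : Rn n) :
    polyFun (w * v) ξ = polyFun w ξ * polyFun v ξ := map_mul _ _ _

lemma polyFun_C (c : ℝ) (ξ : Rn n) : polyFun (MvPolynomial.C c) ξ = c := MvPolynomial.eval_C _

lemma polyFun_X (a : Fin n) (ξ : Rn n) : polyFun (MvPolynomial.X a) ξ = ξ a :=
  MvPolynomial.eval_X _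

lemma polyFun_smul (c : ℝ) (w : MvPolynomial (Fin n) ℝ) (ξ : Rn n) :
    polyFun (c • w) ξ = c * polyFun w ξ := MvPolynomial.smul_eval _ _ _

lemma polyFun_contDiff (w : MvPolynomial (Fin n) ℝ) : ContDiff ℝ ∞ (polyFun w) := by
  induction w using MvPolynomial.induction_on with
  | C c => simpa only [funext (polyFun_C c)] using contDiff_const
  | add p q hp hq => simpa only [funext (polyFun_add p q)] using hp.add hq
  | mul_X p a hp =>
    rw [funext (polyFun_mul p (MvPolynomial.X a))]
    simp only [polyFun_X]
    fun_prop

lemma fderiv_polyFun (w : MvPolynomial (Fin n) ℝ) (ξ : Rn n) (a : Fin n) :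
    fderiv ℝ (polyFun w) ξ (stdVec a) = polyFun (MvPolynomial.pderiv a w) ξ := by
  have hd (w : MvPolynomial (Fin n) ℝ) : DifferentiableAt ℝ (polyFun w) ξ :=
    (polyFun_contDiff w).differentiable (by simp) ξ
  induction w using MvPolynomial.induction_on with
  | C c => simp [funext (polyFun_C c), polyFun]
  | add p q hp hq =>
    have : polyFun (p + q) = polyFun p + polyFun q := funext (polyFun_add p q)
    rw [this, fderiv_add (hd p) (hd q), map_add, polyFun_add, ← hp, ← hq]
    rfl
  | mul_X p b hp =>
    have : polyFun (p * MvPolynomial.X b) = polyFun p * polyFun (MvPolynomial.X b) :=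
      funext (polyFun_mul p _)
    have hX : HasFDerivAt (polyFun (MvPolynomial.X b)) (EuclideanSpace.proj b : Rn n →L[ℝ] ℝ) ξ := by
      rw [funext (polyFun_X b)]
      exact (EuclideanSpace.proj b : Rn n →L[ℝ] ℝ).hasFDerivAt
    rw [this, fderiv_mul (hd p) (hd _), hX.fderiv, Derivation.leibniz, MvPolynomial.pderiv_X]
    simp only [add_apply, smul_apply, smul_eq_mul, polyFun_add, polyFun_mul, hp]
    by_cases hab : a = b
    · subst hab
      simp [stdVec, polyFun]
    · simp [stdVec, Ne.symm hab, polyFun]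

end PolynomialWeights

/-! ### Ray transforms with polynomial weights and integration by parts -/

section WeightTransform

variable {𝕜 : Type*} [RCLike 𝕜] {n : ℕ}

/-- The smooth function `x ↦ ∫∫ t^k w(ξ) ψ(x - tξ, ξ) dt dξ` for a polynomial weight `w`. -/
def weightAdjoint (k : ℕ) (w : MvPolynomial (Fin n) ℝ) (ψ : 𝓓(phaseSpace n, ℝ)) :
    smoothFunctions n :=
  ⟨backProj k (polyFun w) ψ,
    contDiff_infty.2 fun N => backProj_contDiff_nat ψ.hasCompactSupport ψ.tsupport_subset k
      (polyFun_contDiff w).continuous N ψ.contDiff fun _ => image_eq_zero_of_notMem_tsupport⟩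

lemma weightAdjoint_apply (k : ℕ) (w : MvPolynomial (Fin n) ℝ) (ψ : 𝓓(phaseSpace n, ℝ))
    (x : Rn n) : (weightAdjoint k w ψ : Rn n → ℝ) x =
      ∫ q : Rn n × ℝ, q.2 ^ k * polyFun w q.1 * ψ (x - q.2 • q.1, q.1) :=
  backProj_eq ψ.hasCompactSupport ψ.tsupport_subset k (polyFun_contDiff w).continuous
    ψ.continuous (fun _ => image_eq_zero_of_notMem_tsupport) x

lemma integrable_weightAdjoint (k : ℕ) (w : MvPolynomial (Fin n) ℝ) (ψ : 𝓓(phaseSpace n, ℝ))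
    (x : Rn n) :
    Integrable fun q : Rn n × ℝ => q.2 ^ k * polyFun w q.1 * ψ (x - q.2 • q.1, q.1) :=
  integrable_kernel ψ.hasCompactSupport ψ.tsupport_subset k (polyFun_contDiff w).continuous
    ψ.continuous (fun _ => image_eq_zero_of_notMem_tsupport) x

lemma weightAdjoint_add (k : ℕ) (w : MvPolynomial (Fin n) ℝ) (ψ χ : 𝓓(phaseSpace n, ℝ)) :
    weightAdjoint k w (ψ + χ) = weightAdjoint k w ψ + weightAdjoint k w χ := by
  ext x
  change _ = (weightAdjoint k w ψ : Rn n → ℝ) x + (weightAdjoint k w χ : Rn n → ℝ) x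
  rw [weightAdjoint_apply, weightAdjoint_apply, weightAdjoint_apply,
    ← integral_add (integrable_weightAdjoint k w ψ x) (integrable_weightAdjoint k w χ x)]
  simp [mul_add]

lemma weightAdjoint_smul (k : ℕ) (w : MvPolynomial (Fin n) ℝ) (c : ℝ) (ψ : 𝓓(phaseSpace n, ℝ)) :
    weightAdjoint k w (c • ψ) = c • weightAdjoint k w ψ := by
  ext x
  change _ = c * (weightAdjoint k w ψ : Rn n → ℝ) x
  rw [weightAdjoint_apply, weightAdjoint_apply, ← integral_const_mul]
  congr 1; ext q
  change _ * (c * _) = _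
  ring

lemma weightAdjoint_weight_add (k : ℕ) (w v : MvPolynomial (Fin n) ℝ) (ψ : 𝓓(phaseSpace n, ℝ)) :
    weightAdjoint k (w + v) ψ = weightAdjoint k w ψ + weightAdjoint k v ψ := by
  ext x
  change _ = (weightAdjoint k w ψ : Rn n → ℝ) x + (weightAdjoint k v ψ : Rn n → ℝ) x
  rw [weightAdjoint_apply, weightAdjoint_apply, weightAdjoint_apply,
    ← integral_add (integrable_weightAdjoint k w ψ x) (integrable_weightAdjoint k v ψ x)]
  simp [polyFun_add, mul_add, add_mul]

lemma weightAdjoint_weight_smul (k : ℕ) (c : ℝ) (w : MvPolynomial (Fin n) ℝ)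
    (ψ : 𝓓(phaseSpace n, ℝ)) :
    weightAdjoint k (c • w) ψ = c • weightAdjoint k w ψ := by
  ext x
  change _ = c * (weightAdjoint k w ψ : Rn n → ℝ) x
  rw [weightAdjoint_apply, weightAdjoint_apply, ← integral_const_mul]
  congr 1; ext q
  rw [polyFun_smul]
  ring

lemma continuous_weightAdjoint (k : ℕ) (w : MvPolynomial (Fin n) ℝ) (u : compactDistributions 𝕜 n)
    (K : Compacts (Rn n × Rn n)) (hK : (K : Set (Rn n × Rn n)) ⊆ phaseSpace n) :
    Continuous fun ψ : 𝓓_{K}(Rn n × Rn n, ℝ) =>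
      u.1 (weightAdjoint k w (TestFunction.ofSupportedIn hK ψ)) := by
  obtain ⟨L, hL, N, C, hC⟩ := u.2
  obtain ⟨R, hR⟩ := hL.isBounded.exists_norm_le
  obtain ⟨C', hC', h⟩ := backProj_iteratedFDeriv_bound K.isCompact hK k
    (polyFun_contDiff w).continuous R
  refine (ContDiffMapSupportedIn.mkCLMtoNormedSpace ℝ
    (fun ψ : 𝓓_{K}(Rn n × Rn n, ℝ) => u.1 (weightAdjoint k w (TestFunction.ofSupportedIn hK ψ)))
    ?_ ?_ ⟨Finset.Iic N, |C| * C', by positivity, ?_⟩).continuous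
  · intro ψ χ
    rw [← map_add, ← weightAdjoint_add]; rfl
  · intro c ψ
    rw [← map_smul, ← weightAdjoint_smul]; rfl
  · intro ψ
    set S := (Finset.Iic N).sup (fun l => N[ℝ]_{K, l}) ψ
    have hS : 0 ≤ S := apply_nonneg _ _
    calc _ ≤ C * (C' * S) := by
          refine hC _ _ (by positivity) fun l hl x hx => ?_
          refine h l ψ.contDiff (fun q hq => ψ.zero_on_compl hq) S hS (fun q => ?_) x (hR x hx)
          exact (ContDiffMapSupportedIn.norm_iteratedFDeriv_apply_le_seminorm_top ℝ).trans
            (Seminorm.le_finset_sup_apply (Finset.mem_Iic.2 hl))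
      _ ≤ |C| * (C' * S) := by gcongr; exact le_abs_self C
      _ = |C| * C' * S := by ring

/-- The distribution `ψ ↦ ⟨u, ∫∫ t^k w(ξ) ψ(x - tξ, ξ) dt dξ⟩` for a polynomial weight `w`. -/
def weightTransform (k : ℕ) (w : MvPolynomial (Fin n) ℝ) (u : compactDistributions 𝕜 n) :
    𝓓'(phaseSpace n, 𝕜) :=
  TestFunction.mkCLM ℝ (fun ψ => u.1 (weightAdjoint k w ψ))
    (fun ψ χ => by rw [weightAdjoint_add, map_add])
    (fun c ψ => by rw [weightAdjoint_smul, map_smul])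
    (fun K hK => continuous_weightAdjoint k w u K hK)

lemma weightTransform_apply (k : ℕ) (w : MvPolynomial (Fin n) ℝ) (u : compactDistributions 𝕜 n)
    (ψ : 𝓓(phaseSpace n, ℝ)) : weightTransform k w u ψ = u.1 (weightAdjoint k w ψ) := rfl

/-- Passing from monomials to all polynomials makes the class of weights stable under ∂/∂ξ^a and
under multiplication by ξ^a. -/
lemma componentTransform_eq {p : ℕ} (k : ℕ) (i : Fin p → Fin n) (u : compactDistributions 𝕜 n) :
    componentTransform k i u = weightTransform k (∏ s, MvPolynomial.X (i s)) u := by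
  ext ψ
  change u.1 (adjoint k i ψ) = u.1 (weightAdjoint k _ ψ)
  have h : monomial i = polyFun (∏ s, MvPolynomial.X (i s)) := by
    ext ξ
    simp [monomial, polyFun, map_prod]
  congr 1
  ext x
  rw [adjoint_coe, h]
  rfl

lemma weightTransform_add (k : ℕ) (w v : MvPolynomial (Fin n) ℝ) (u : compactDistributions 𝕜 n) :
    weightTransform k (w + v) u = weightTransform k w u + weightTransform k v u := by
  ext ψ
  rw [add_apply, weightTransform_apply, weightTransform_apply, weightTransform_apply,
    weightAdjoint_weight_add, map_add]

lemma weightTransform_smul (k : ℕ) (c : ℝ) (w : MvPolynomial (Fin n) ℝ)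
    (u : compactDistributions 𝕜 n) :
    weightTransform k (c • w) u = c • weightTransform k w u := by
  ext ψ
  rw [smul_apply, weightTransform_apply, weightTransform_apply,
    weightAdjoint_weight_smul, map_smul]

/-- `weightTransform` as a linear function of the weight. -/
def weightTransformₗ (k : ℕ) (u : compactDistributions 𝕜 n) :
    MvPolynomial (Fin n) ℝ →ₗ[ℝ] 𝓓'(phaseSpace n, 𝕜) where
  toFun w := weightTransform k w u
  map_add' w v := weightTransform_add k w v u
  map_smul' c w := weightTransform_smul k c w u

lemma weightTransform_zero (k : ℕ) (u : compactDistributions 𝕜 n) :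
    weightTransform k 0 u = 0 := map_zero (weightTransformₗ k u)

lemma weightTransform_sum {ι : Type*} (s : Finset ι) (k : ℕ) (w : ι → MvPolynomial (Fin n) ℝ)
    (u : compactDistributions 𝕜 n) :
    weightTransform k (∑ a ∈ s, w a) u = ∑ a ∈ s, weightTransform k (w a) u :=
  map_sum (weightTransformₗ k u) w s

lemma xiMul_weightTransform (a : Fin n) (k : ℕ) (w : MvPolynomial (Fin n) ℝ)
    (u : compactDistributions 𝕜 n) :
    xiMul a (weightTransform k w u) = weightTransform k (MvPolynomial.X a * w) u := by
  ext ψ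
  rw [xiMul, smoothMul_apply, weightTransform_apply, weightTransform_apply]
  congr 1
  ext x
  rw [weightAdjoint_apply, weightAdjoint_apply]
  congr 1; ext q
  rw [mulTest_apply, polyFun_mul, polyFun_X]
  ring

/-- The integral over `ℝⁿ × ℝ` of a derivative of a compactly supported function vanishes. -/
lemma integral_fderiv_eq_zero {g : Rn n × ℝ → ℝ} (hg : ContDiff ℝ ∞ g) (hc : HasCompactSupport g)
    (v : Rn n × ℝ) : ∫ q, fderiv ℝ g q v = 0 := by
  have hd : Continuous fun q => fderiv ℝ g q v :=
    (hg.continuous_fderiv (by simp)).clm_apply continuous_const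
  have hcd : HasCompactSupport fun q => fderiv ℝ g q v := hc.fderiv_apply (𝕜 := ℝ) v
  have : (volume : Measure (Rn n × ℝ)).IsAddHaarMeasure :=
    inferInstanceAs ((volume : Measure (Rn n)).prod (volume : Measure ℝ)).IsAddHaarMeasure
  -- Integration by parts against the constant function 1.
  have := integral_mul_fderiv_eq_neg_fderiv_mul_of_integrable (μ := (volume : Measure (Rn n × ℝ)))
    (f := fun _ : Rn n × ℝ => (1 : ℝ)) (g := g) (v := v) (by simp)
    (by simpa using hd.integrable_of_hasCompactSupport hcd)
    (by simpa using hg.continuous.integrable_of_hasCompactSupport hc)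
    (fun _ _ => differentiableAt_const _) (fun x _ => hg.differentiable (by simp) x)
  simpa using this

/-- The integrand `t^k w(ξ) ψ(x - tξ, ξ)` as a function of `(ξ, t)`. -/
def kernelFun (k : ℕ) (w : MvPolynomial (Fin n) ℝ) (ψ : 𝓓(phaseSpace n, ℝ)) (x : Rn n)
    (q : Rn n × ℝ) : ℝ := q.2 ^ k * polyFun w q.1 * ψ (x - q.2 • q.1, q.1)

lemma kernelFun_contDiff (k : ℕ) (w : MvPolynomial (Fin n) ℝ) (ψ : 𝓓(phaseSpace n, ℝ))
    (x : Rn n) : ContDiff ℝ ∞ (kernelFun k w ψ x) := by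
  have hψ : ContDiff ℝ ∞ (ψ : Rn n × Rn n → ℝ) := ψ.contDiff
  have hw := polyFun_contDiff w
  unfold kernelFun
  fun_prop

/-- On the support of `ψ` the direction ξ stays away from 0, so bounded x - tξ confines t; this
removes all boundary terms below. -/
lemma kernelFun_hasCompactSupport (k : ℕ) (w : MvPolynomial (Fin n) ℝ) (ψ : 𝓓(phaseSpace n, ℝ))
    (x : Rn n) : HasCompactSupport (kernelFun k w ψ x) := by
  obtain ⟨B, hB, hBx⟩ := exists_box ψ.hasCompactSupport ψ.tsupport_subset ‖x‖
  refine HasCompactSupport.intro hB fun q hq => ?_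
  rw [kernelFun, image_eq_zero_of_notMem_tsupport fun h => hq (hBx x le_rfl _ _ h), mul_zero]

lemma fderiv_kernelFun (k : ℕ) (w : MvPolynomial (Fin n) ℝ) (ψ : 𝓓(phaseSpace n, ℝ)) (x : Rn n)
    (q v : Rn n × ℝ) :
    fderiv ℝ (kernelFun k w ψ x) q v =
      (k * q.2 ^ (k - 1) * v.2 * polyFun w q.1 + q.2 ^ k * fderiv ℝ (polyFun w) q.1 v.1)
          * ψ (x - q.2 • q.1, q.1)
        + q.2 ^ k * polyFun w q.1 *
          fderiv ℝ ψ (x - q.2 • q.1, q.1) (-(q.2 • v.1 + v.2 • q.1), v.1) := by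
  have h1 : HasFDerivAt (fun q : Rn n × ℝ => q.2) (ContinuousLinearMap.snd ℝ (Rn n) ℝ) q :=
    hasFDerivAt_snd
  have h1' : HasFDerivAt (fun q : Rn n × ℝ => q.1) (ContinuousLinearMap.fst ℝ (Rn n) ℝ) q :=
    hasFDerivAt_fst
  have h2 : HasFDerivAt (fun q : Rn n × ℝ => polyFun w q.1) _ q :=
    ((polyFun_contDiff w).differentiable (by simp) q.1).hasFDerivAt.comp q h1'
  have h3 : HasFDerivAt (fun q : Rn n × ℝ => (x - q.2 • q.1, q.1)) _ q :=
    ((h1.smul h1').const_sub x).prodMk h1'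
  have h4 : HasFDerivAt (fun q : Rn n × ℝ => ψ (x - q.2 • q.1, q.1)) _ q :=
    (ψ.contDiff.differentiable (by simp) (x - q.2 • q.1, q.1)).hasFDerivAt.comp q h3
  have h5 : HasFDerivAt (kernelFun k w ψ x) _ q := ((h1.pow k).mul h2).mul h4
  rw [h5.fderiv]
  simp
  ring

/-- Integration by parts in `ξ`. -/
lemma weightAdjoint_pderiv (a : Fin n) (k : ℕ) (w : MvPolynomial (Fin n) ℝ)
    (ψ : 𝓓(phaseSpace n, ℝ)) :
    weightAdjoint k (MvPolynomial.pderiv a w) ψ =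
      weightAdjoint (k + 1) w (∂_{(stdVec a, (0 : Rn n))} ψ)
        - weightAdjoint k w (∂_{((0 : Rn n), stdVec a)} ψ) := by
  ext x
  change _ = (weightAdjoint (k + 1) w (∂_{(stdVec a, (0 : Rn n))} ψ) : Rn n → ℝ) x
    - (weightAdjoint k w (∂_{((0 : Rn n), stdVec a)} ψ) : Rn n → ℝ) x
  rw [eq_sub_iff_add_eq, ← sub_eq_zero]
  -- The derivative in the direction ξ^a also hits the argument x - tξ; this produces the extra
  -- factor t and hence the moment k + 1.
  have h := integral_fderiv_eq_zero (kernelFun_contDiff k w ψ x)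
    (kernelFun_hasCompactSupport k w ψ x) (stdVec a, 0)
  rw [← h, weightAdjoint_apply, weightAdjoint_apply, weightAdjoint_apply,
    ← integral_add (integrable_weightAdjoint _ _ _ x) (integrable_weightAdjoint _ _ _ x),
    ← integral_sub ((integrable_weightAdjoint _ _ _ x).fun_add (integrable_weightAdjoint _ _ _ x))
      (integrable_weightAdjoint _ _ _ x)]
  congr 1; ext q
  have e : ((-(q.2 • stdVec a + (0 : ℝ) • q.1), stdVec a) : Rn n × Rn n) =
      ((0 : Rn n), stdVec a) - q.2 • (stdVec a, (0 : Rn n)) := by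
    simp
  rw [fderiv_kernelFun, testFunction_lineDerivOp_apply, testFunction_lineDerivOp_apply,
    fderiv_polyFun, e, map_sub, map_smul]
  simp only [smul_eq_mul]
  ring

/-- Integration by parts in `t`. -/
lemma sum_weightAdjoint_X_mul (k : ℕ) (w : MvPolynomial (Fin n) ℝ) (ψ : 𝓓(phaseSpace n, ℝ)) :
    ∑ a, weightAdjoint (k + 1) (MvPolynomial.X a * w) (∂_{(stdVec a, (0 : Rn n))} ψ) =
      ((k : ℝ) + 1) • weightAdjoint k w ψ := by
  ext x
  rw [Submodule.coe_sum, Finset.sum_apply]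
  change _ = ((k : ℝ) + 1) * (weightAdjoint k w ψ : Rn n → ℝ) x
  -- The t-derivative falls either on t^(k+1), which gives (k+1) t^k, or on x - tξ, which gives -∑
  -- ξ^a ∂/∂x^a.
  have h := integral_fderiv_eq_zero (kernelFun_contDiff (k + 1) w ψ x)
    (kernelFun_hasCompactSupport (k + 1) w ψ x) (0, 1)
  rw [← sub_eq_zero, ← neg_eq_zero, ← h]
  simp only [weightAdjoint_apply]
  rw [← integral_finsetSum _ fun a _ => integrable_weightAdjoint _ _ _ x, ← integral_const_mul,
    ← integral_sub (integrable_finsetSum _ fun a _ => integrable_weightAdjoint _ _ _ x)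
      ((integrable_weightAdjoint _ _ _ x).const_mul _), ← integral_neg]
  congr 1; ext q
  have e : ((-(q.2 • (0 : Rn n) + (1 : ℝ) • q.1), 0) : Rn n × Rn n) =
      - ∑ a, q.1 a • (stdVec a, (0 : Rn n)) := by
    refine Prod.ext ?_ ?_
    · ext b
      simp [stdVec, Prod.fst_sum, Finset.sum_apply, Pi.single_apply]
    · simp [Prod.snd_sum]
  rw [fderiv_kernelFun, e, map_neg, map_sum]
  simp only [map_smul, smul_eq_mul, testFunction_lineDerivOp_apply, map_zero, polyFun_mul, polyFun_X]
  rw [mul_neg, Finset.mul_sum]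
  have (a : Fin n) : q.2 ^ (k + 1) * (q.1 a * polyFun w q.1) *
      fderiv ℝ ψ (x - q.2 • q.1, q.1) (stdVec a, 0) = q.2 ^ (k + 1) * polyFun w q.1 *
      (q.1 a * fderiv ℝ ψ (x - q.2 • q.1, q.1) (stdVec a, 0)) := by ring
  simp only [this]
  push_cast
  ring

/-- The dual of integration by parts in ξ; passing to the adjoint reverses the signs of both
derivatives. It trades derivatives of the distribution for derivatives of the weight. -/
lemma weightTransform_pderiv (a : Fin n) (k : ℕ) (w : MvPolynomial (Fin n) ℝ)
    (u : compactDistributions 𝕜 n) :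
    ∂_{((0 : Rn n), stdVec a)} (weightTransform k w u)
        - ∂_{(stdVec a, (0 : Rn n))} (weightTransform (k + 1) w u) =
      weightTransform k (MvPolynomial.pderiv a w) u := by
  ext ψ
  rw [sub_apply, Distribution.lineDerivOp_apply_apply, Distribution.lineDerivOp_apply_apply,
    map_neg, map_neg, weightTransform_apply, weightTransform_apply, weightTransform_apply,
    weightAdjoint_pderiv, map_sub]
  abel

/-- Since ξ^a commutes with ∂/∂x^a, it can be absorbed into the weight, and what remains is the dual
of integration by parts in t. -/
lemma sum_xiMul_lineDerivOp_weightTransform (k : ℕ) (w : MvPolynomial (Fin n) ℝ)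
    (u : compactDistributions 𝕜 n) :
    ∑ a, xiMul a (∂_{(stdVec a, (0 : Rn n))} (weightTransform (k + 1) w u)) =
      -((k : ℝ) + 1) • weightTransform k w u := by
  have h (a : Fin n) : xiMul a (∂_{(stdVec a, (0 : Rn n))} (weightTransform (k + 1) w u)) =
      ∂_{(stdVec a, (0 : Rn n))} (weightTransform (k + 1) (MvPolynomial.X a * w) u) := by
    rw [← xiMul_weightTransform]
    ext ψ
    rw [xiMul, xiMul, smoothMul_apply, Distribution.lineDerivOp_apply_apply,
      Distribution.lineDerivOp_apply_apply, smoothMul_apply, map_neg, map_neg, map_neg]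
    congr 2
    ext q
    have h1 : HasFDerivAt (fun q : Rn n × Rn n => q.2 a)
        ((EuclideanSpace.proj a : Rn n →L[ℝ] ℝ).comp (ContinuousLinearMap.snd ℝ (Rn n) (Rn n))) q :=
      ((EuclideanSpace.proj a : Rn n →L[ℝ] ℝ).comp
        (ContinuousLinearMap.snd ℝ (Rn n) (Rn n))).hasFDerivAt
    have h2 := ((ψ.contDiff.differentiable (by simp) q).hasFDerivAt.mul h1).fderiv
    have h3 : (mulTest (fun q => q.2 a) (contDiff_sndCoord a) ψ : Rn n × Rn n → ℝ)
      = (ψ : Rn n × Rn n → ℝ) * fun q => q.2 a := rfl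
    rw [mulTest_apply, testFunction_lineDerivOp_apply, testFunction_lineDerivOp_apply, h3, h2]
    simp
    ring
  simp only [h]
  ext ψ
  rw [sum_apply]
  simp only [Distribution.lineDerivOp_apply_apply, map_neg, weightTransform_apply]
  rw [Finset.sum_neg_distrib, ← map_sum, sum_weightAdjoint_X_mul, map_smul, smul_apply,
    weightTransform_apply, neg_smul]

/-- `I^0` with a weight homogeneous of degree `d` is homogeneous of degree `d - 1` in `ξ`. -/
lemma eulerField_weightTransform {d : ℕ} {w : MvPolynomial (Fin n) ℝ} (hw : w.IsHomogeneous d)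
    (u : compactDistributions 𝕜 n) :
    eulerField (weightTransform 0 w u) = ((d : ℝ) - 1) • weightTransform 0 w u := by
  -- Summed over a, the first term on the right gives minus the transform (the t-identity with k =
  -- 0), and the second gives d times it by Euler's identity for `w`.
  have h (a : Fin n) : xiMul a (∂_{((0 : Rn n), stdVec a)} (weightTransform 0 w u)) =
      xiMul a (∂_{(stdVec a, (0 : Rn n))} (weightTransform 1 w u)) +
        weightTransform 0 (MvPolynomial.X a * MvPolynomial.pderiv a w) u := by
    rw [← xiMul_weightTransform, ← weightTransform_pderiv, xiMul, xiMul, xiMul, ← smoothMul_add]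
    congr 1
    abel
  rw [eulerField, Finset.sum_congr rfl fun a _ => h a, Finset.sum_add_distrib,
    sum_xiMul_lineDerivOp_weightTransform, ← weightTransform_sum, hw.sum_X_mul_pderiv,
    ← Nat.cast_smul_eq_nsmul ℝ, weightTransform_smul]
  push_cast
  module

end WeightTransform

/-! ### Iterated partial derivatives of polynomials -/

section IteratedPderiv

open MvPolynomial

variable {n : ℕ}

/-- The commutator of two derivations is a derivation, and this one vanishes on the variables. -/
lemma pderiv_comm (a b : Fin n) (w : MvPolynomial (Fin n) ℝ) :
    pderiv a (pderiv b w) = pderiv b (pderiv a w) := by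
  have h : ⁅(pderiv a : Derivation ℝ (MvPolynomial (Fin n) ℝ) (MvPolynomial (Fin n) ℝ)),
      (pderiv b : Derivation ℝ (MvPolynomial (Fin n) ℝ) (MvPolynomial (Fin n) ℝ))⁆ = 0 := by
    refine MvPolynomial.derivation_ext fun c => ?_
    rw [Derivation.commutator_apply]
    simp only [pderiv_X, Pi.single_apply, apply_ite, map_zero, Derivation.map_one_eq_zero]
    simp
  have := congrArg (fun D : Derivation ℝ (MvPolynomial (Fin n) ℝ) (MvPolynomial (Fin n) ℝ) => D w) h
  rw [Derivation.commutator_apply] at this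
  exact sub_eq_zero.1 this

/-- The iterated partial derivative `∂^j w / ∂ξ^{i₁} ⋯ ∂ξ^{i_j}` of a polynomial. -/
def iterPderiv {j : ℕ} (i : Fin j → Fin n) (w : MvPolynomial (Fin n) ℝ) :
    MvPolynomial (Fin n) ℝ :=
  (List.ofFn i).foldr (fun a v => pderiv a v) w

lemma iterPderiv_zero (i : Fin 0 → Fin n) (w : MvPolynomial (Fin n) ℝ) : iterPderiv i w = w := by
  simp [iterPderiv]

lemma iterPderiv_succ {j : ℕ} (i : Fin (j + 1) → Fin n) (w : MvPolynomial (Fin n) ℝ) :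
    iterPderiv i w = pderiv (i 0) (iterPderiv (Fin.tail i) w) := by
  simp [iterPderiv, List.ofFn_succ, Fin.tail_def]

lemma iterPderiv_comp_perm {j : ℕ} (i : Fin j → Fin n) (σ : Equiv.Perm (Fin j))
    (w : MvPolynomial (Fin n) ℝ) : iterPderiv (i ∘ σ) w = iterPderiv i w := by
  have : LeftCommutative fun (a : Fin n) (v : MvPolynomial (Fin n) ℝ) => pderiv a v :=
    ⟨fun a b v => pderiv_comm a b v⟩
  exact (Equiv.Perm.ofFn_comp_perm σ i).foldr_eq w

lemma pderiv_iterPderiv {j : ℕ} (a : Fin n) (i : Fin j → Fin n) (w : MvPolynomial (Fin n) ℝ) :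
    pderiv a (iterPderiv i w) = iterPderiv i (pderiv a w) := by
  induction j with
  | zero => simp [iterPderiv_zero]
  | succ j ih => rw [iterPderiv_succ, iterPderiv_succ, pderiv_comm, ih]

lemma iterPderiv_add {j : ℕ} (i : Fin j → Fin n) (w v : MvPolynomial (Fin n) ℝ) :
    iterPderiv i (w + v) = iterPderiv i w + iterPderiv i v := by
  induction j with
  | zero => simp [iterPderiv_zero]
  | succ j ih => rw [iterPderiv_succ, iterPderiv_succ, iterPderiv_succ, ih, map_add]

lemma iterPderiv_weight_zero {j : ℕ} (i : Fin j → Fin n) : iterPderiv i 0 = 0 := by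
  induction j with
  | zero => simp [iterPderiv_zero]
  | succ j ih => rw [iterPderiv_succ, ih, map_zero]

lemma iterPderiv_sum {j : ℕ} {ι : Type*} (s : Finset ι) (i : Fin j → Fin n)
    (w : ι → MvPolynomial (Fin n) ℝ) :
    iterPderiv i (∑ a ∈ s, w a) = ∑ a ∈ s, iterPderiv i (w a) := by
  classical
  induction s using Finset.induction_on with
  | empty => simp [iterPderiv_weight_zero]
  | insert a s ha ih => rw [Finset.sum_insert ha, Finset.sum_insert ha, iterPderiv_add, ih]

lemma isHomogeneous_iterPderiv {j p : ℕ} (i : Fin j → Fin n) {w : MvPolynomial (Fin n) ℝ}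
    (hw : w.IsHomogeneous p) : (iterPderiv i w).IsHomogeneous (p - j) := by
  induction j with
  | zero => simpa [iterPderiv_zero] using hw
  | succ j ih =>
    rw [iterPderiv_succ, ← Nat.sub_sub]
    exact (ih _).pderiv

lemma iterPderiv_eq_zero {j p : ℕ} (i : Fin j → Fin n) {w : MvPolynomial (Fin n) ℝ}
    (hw : w.IsHomogeneous p) (hp : p < j) : iterPderiv i w = 0 := by
  induction j with
  | zero => omega
  | succ j ih =>
    rw [iterPderiv_succ]
    rcases Nat.lt_succ_iff_lt_or_eq.1 hp with h | rfl
    · rw [ih _ h, map_zero]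
    -- After exactly p derivatives the polynomial is constant, and the next one kills it.
    · have h := isHomogeneous_iterPderiv (Fin.tail i) hw
      rw [Nat.sub_self] at h
      rw [totalDegree_eq_zero_iff_eq_C.1 (Nat.le_zero.1 h.totalDegree_le), pderiv_C]

lemma isHomogeneous_prod_X {p : ℕ} (I : Fin p → Fin n) :
    (∏ s, X (I s) : MvPolynomial (Fin n) ℝ).IsHomogeneous p := by
  simpa using IsHomogeneous.prod Finset.univ (fun s => (X (I s) : MvPolynomial (Fin n) ℝ))
    (fun _ => 1) fun s _ => isHomogeneous_X ℝ (I s)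

lemma pderiv_prod {ι : Type*} [DecidableEq ι] (S : Finset ι) (a : Fin n)
    (f : ι → MvPolynomial (Fin n) ℝ) :
    pderiv a (∏ s ∈ S, f s) = ∑ s ∈ S, pderiv a (f s) * ∏ t ∈ S.erase s, f t := by
  induction S using Finset.induction_on with
  | empty => simp
  | insert b S hb ih =>
    rw [Finset.prod_insert hb, Derivation.leibniz, ih, Finset.sum_insert hb,
      Finset.erase_insert hb, smul_eq_mul, smul_eq_mul, Finset.mul_sum, add_comm, mul_comm]
    congr 1
    refine Finset.sum_congr rfl fun s hs => ?_
    have hbs : b ≠ s := fun h => hb (h ▸ hs)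
    rw [Finset.erase_insert_of_ne hbs, Finset.prod_insert fun h => hb (Finset.mem_of_mem_erase h)]
    ring

/-- The map t ↦ `Equiv.swap 0 s t.succ` enumerates the indices other than `s`, in the form that
`Equiv.Perm.decomposeFin` uses for permutations sending 0 to `s`. -/
lemma prod_erase_eq_swap {j : ℕ} (f : Fin (j + 1) → MvPolynomial (Fin n) ℝ) (s : Fin (j + 1)) :
    ∏ t ∈ Finset.univ.erase s, f t = ∏ t : Fin j, f (Equiv.swap 0 s t.succ) := by
  rw [← Finset.prod_image (s := Finset.univ) (g := fun t : Fin j => Equiv.swap 0 s t.succ)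
    (f := f) fun t _ t' _ h => Fin.succ_injective _ ((Equiv.swap 0 s).injective h)]
  congr 1
  ext t
  simp only [Finset.mem_erase, Finset.mem_univ, and_true, Finset.mem_image, true_and]
  constructor
  · intro h
    have h0 : Equiv.swap 0 s t ≠ 0 := by
      intro h'
      apply h
      rw [← Equiv.swap_apply_self 0 s t, h', Equiv.swap_apply_left]
    obtain ⟨a, ha⟩ := Fin.exists_succ_eq.2 h0
    exact ⟨a, by rw [ha, Equiv.swap_apply_self]⟩
  · rintro ⟨a, rfl⟩ h
    have := (Equiv.swap 0 s).injective (h.trans (Equiv.swap_apply_left 0 s).symm)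
    exact Fin.succ_ne_zero _ this

/-- `∂^j (ξ^{I₁} ⋯ ξ^{I_j}) / ∂ξ^{i₁} ⋯ ∂ξ^{i_j}` is the number of permutations carrying `I`
to `i`. -/
lemma iterPderiv_prod_X {j : ℕ} (i I : Fin j → Fin n) :
    iterPderiv i (∏ s, X (I s)) =
      ∑ π : Equiv.Perm (Fin j), if I ∘ π = i then (1 : MvPolynomial (Fin n) ℝ) else 0 := by
  induction j with
  | zero =>
    rw [iterPderiv_zero]
    simp [eq_iff_true_of_subsingleton]
  | succ j ih =>
    -- The derivative in `i 0` is applied first. The factor `s` that it hits becomes the value π 0,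
    -- and the other j derivatives act on the remaining factors.
    rw [iterPderiv_succ, pderiv_iterPderiv, pderiv_prod, iterPderiv_sum,
      ← Equiv.Perm.decomposeFin.symm.sum_comp, Fintype.sum_prod_type]
    refine Finset.sum_congr rfl fun s _ => ?_
    rw [prod_erase_eq_swap, pderiv_X]
    by_cases hs : I s = i 0
    · rw [hs, Pi.single_eq_same, one_mul, ih (Fin.tail i) fun t => I (Equiv.swap 0 s t.succ)]
      refine Finset.sum_congr rfl fun e _ => ?_
      congr 1
      rw [funext_iff, funext_iff, Fin.forall_fin_succ]
      simp [hs, Fin.tail]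
    · rw [Pi.single_eq_of_ne hs, zero_mul, iterPderiv_weight_zero]
      refine (Finset.sum_eq_zero fun e _ => if_neg fun h => hs ?_).symm
      simpa using congrFun h 0

end IteratedPderiv

/-! ### Symmetrized alternating sums of mixed derivatives -/

section AlternatingDerivative

variable {𝕜 : Type*} [RCLike 𝕜] {n : ℕ}

lemma distribution_zero_smul (T : 𝓓'(phaseSpace n, 𝕜)) : (0 : ℝ) • T = 0 := by
  ext ψ
  simp

lemma distribution_smul_zero (c : ℝ) : c • (0 : 𝓓'(phaseSpace n, 𝕜)) = 0 := by
  ext ψ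
  simp

lemma eulerOp_zero (r : ℕ) : eulerOp r (0 : 𝓓'(phaseSpace n, 𝕜)) = 0 := by
  simpa only [distribution_zero_smul] using eulerOp_smul r 0 (0 : 𝓓'(phaseSpace n, 𝕜))

/-- The combination `∑_k (-1)^k (j choose k) ∂^j T_{k₀+k} / ∂x^{i₁}⋯∂x^{i_k} ∂ξ^{i_{k+1}}⋯∂ξ^{i_j}` of
derivatives of a sequence of distributions. -/
def altDeriv {j : ℕ} (k₀ : ℕ) (i : Fin j → Fin n) (T : ℕ → 𝓓'(phaseSpace n, 𝕜)) :
    𝓓'(phaseSpace n, 𝕜) :=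
  ∑ k ∈ Finset.range (j + 1), ((-1 : ℝ) ^ k * (j.choose k : ℝ)) • mixedDeriv k i (T (k₀ + k))

lemma mixedDeriv_succ_succ {j : ℕ} (k : ℕ) (i : Fin (j + 1) → Fin n) (T : 𝓓'(phaseSpace n, 𝕜)) :
    mixedDeriv (k + 1) i T =
      ∂_{(stdVec (i 0), (0 : Rn n))} (mixedDeriv k (Fin.tail i) T) := by
  rw [mixedDeriv, LineDeriv.iteratedLineDerivOp_succ_left, mixedDeriv]
  simp only [Fin.tail_def, Fin.val_succ, Nat.add_lt_add_iff_right, Fin.val_zero, Nat.succ_pos,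
    if_true]

lemma mixedDeriv_of_le {j k : ℕ} (hk : k ≤ j) (i : Fin (j + 1) → Fin n)
    (T : 𝓓'(phaseSpace n, 𝕜)) :
    mixedDeriv k i T =
      ∂_{((0 : Rn n), stdVec (i (Fin.last j)))} (mixedDeriv k (Fin.init i) T) := by
  rw [mixedDeriv, LineDeriv.iteratedLineDerivOp_succ_right, mixedDeriv, lineDerivOp_iterated_comm]
  simp only [Fin.init_def, Fin.val_castSucc, Fin.val_last, not_lt.2 hk, if_false]

/-- Pascal's rule: the terms with `j.choose k` split off the last slot, a ξ-derivative, and those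
with `j.choose (k - 1)` split off the first slot, an x-derivative. The latter raises the starting
moment by one. -/
lemma altDeriv_succ {j : ℕ} (k₀ : ℕ) (i : Fin (j + 1) → Fin n) (T : ℕ → 𝓓'(phaseSpace n, 𝕜)) :
    altDeriv k₀ i T =
      ∂_{((0 : Rn n), stdVec (i (Fin.last j)))} (altDeriv k₀ (Fin.init i) T)
        - ∂_{(stdVec (i 0), (0 : Rn n))} (altDeriv (k₀ + 1) (Fin.tail i) T) := by
  have h1 : ∂_{((0 : Rn n), stdVec (i (Fin.last j)))} (altDeriv k₀ (Fin.init i) T) =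
      ∑ k ∈ Finset.range (j + 2), ((-1 : ℝ) ^ k * (j.choose k : ℝ)) •
        mixedDeriv k i (T (k₀ + k)) := by
    -- The extra term k = j + 1 has coefficient zero; it is included so that both sums match
    -- Pascal's rule.
    rw [Finset.sum_range_succ, Nat.choose_succ_self, Nat.cast_zero, mul_zero, distribution_zero_smul,
      add_zero, altDeriv, LineDeriv.lineDerivOp_sum]
    refine Finset.sum_congr rfl fun k hk => ?_
    rw [LineDeriv.lineDerivOp_smul, mixedDeriv_of_le (Nat.lt_succ_iff.1 (Finset.mem_range.1 hk))]
  have h2 : ∂_{(stdVec (i 0), (0 : Rn n))} (altDeriv (k₀ + 1) (Fin.tail i) T) =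
      ∑ k ∈ Finset.range (j + 1), ((-1 : ℝ) ^ k * (j.choose k : ℝ)) •
        mixedDeriv (k + 1) i (T (k₀ + (k + 1))) := by
    rw [altDeriv, LineDeriv.lineDerivOp_sum]
    refine Finset.sum_congr rfl fun k _ => ?_
    rw [LineDeriv.lineDerivOp_smul, mixedDeriv_succ_succ, add_assoc, add_comm 1 k]
  rw [h1, h2, altDeriv, Finset.sum_range_succ', Finset.sum_range_succ' _ (j + 1), add_sub_right_comm,
    ← Finset.sum_sub_distrib]
  congr 1
  · refine Finset.sum_congr rfl fun k _ => ?_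
    rw [Nat.choose_succ_succ, pow_succ]
    push_cast
    module
  · simp

lemma altDeriv_sum {ι : Type*} (s : Finset ι) {j : ℕ} (k₀ : ℕ) (i : Fin j → Fin n)
    (T : ι → ℕ → 𝓓'(phaseSpace n, 𝕜)) :
    altDeriv k₀ i (fun k => ∑ a ∈ s, T a k) = ∑ a ∈ s, altDeriv k₀ i (T a) := by
  simp only [altDeriv, mixedDeriv, LineDeriv.iteratedLineDerivOp_sum, Finset.smul_sum]
  exact Finset.sum_comm

/-- `altDeriv_succ` removes different slots in its two terms. After summation over all permutations,
a cyclic shift makes both remove the slot 0, so that the two derivatives carry the same index i p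
and can be combined. -/
lemma sum_perm_altDeriv_succ {j : ℕ} (k₀ : ℕ) (i : Fin (j + 1) → Fin n)
    (T : ℕ → 𝓓'(phaseSpace n, 𝕜)) :
    ∑ π : Equiv.Perm (Fin (j + 1)), altDeriv k₀ (i ∘ π) T =
      ∑ p, (∂_{((0 : Rn n), stdVec (i p))}
          (∑ e : Equiv.Perm (Fin j), altDeriv k₀ ((fun t => i (Equiv.swap 0 p t.succ)) ∘ e) T)
        - ∂_{(stdVec (i p), (0 : Rn n))}
          (∑ e : Equiv.Perm (Fin j),
            altDeriv (k₀ + 1) ((fun t => i (Equiv.swap 0 p t.succ)) ∘ e) T)) := by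
  have h1 : ∑ π : Equiv.Perm (Fin (j + 1)), ∂_{((0 : Rn n), stdVec ((i ∘ π) (Fin.last j)))}
        (altDeriv k₀ (Fin.init (i ∘ π)) T) =
      ∑ π : Equiv.Perm (Fin (j + 1)), ∂_{((0 : Rn n), stdVec (i (π 0)))}
        (altDeriv k₀ (Fin.tail (i ∘ π)) T) := by
    -- The rotation sends the last slot to 0 and each other slot s to s + 1, so initial segments
    -- become tails.
    rw [← Equiv.sum_comp (Equiv.mulRight (finRotate (j + 1)))]
    refine Finset.sum_congr rfl fun π _ => ?_
    have e : Fin.init (i ∘ (Equiv.mulRight (finRotate (j + 1)) π)) = Fin.tail (i ∘ π) := by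
      ext s
      simp only [Fin.init, Fin.tail, Function.comp_apply, Equiv.coe_mulRight, Equiv.Perm.mul_apply]
      congr 3
      exact finRotate_of_lt s.2
    rw [e, Function.comp_apply, Equiv.coe_mulRight, Equiv.Perm.mul_apply, finRotate_last]
  simp only [altDeriv_succ]
  rw [Finset.sum_sub_distrib, h1, ← Finset.sum_sub_distrib,
    ← Equiv.Perm.decomposeFin.symm.sum_comp, Fintype.sum_prod_type]
  refine Finset.sum_congr rfl fun p _ => ?_
  have e (e : Equiv.Perm (Fin j)) : Fin.tail (i ∘ (Equiv.Perm.decomposeFin.symm (p, e))) =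
      (fun t => i (Equiv.swap 0 p t.succ)) ∘ e := by
    ext s
    simp [Fin.tail]
  simp only [Finset.sum_sub_distrib, e, Equiv.Perm.decomposeFin_symm_apply_zero,
    LineDeriv.lineDerivOp_sum, Function.comp_apply]

/-- In each summand of the recursion `weightTransform_pderiv` moves one derivative onto the weight.
All j + 1 choices of the removed index give the same result, because partial derivatives commute. -/
lemma sum_perm_altDeriv_weightTransform {j : ℕ} (k₀ : ℕ) (i : Fin j → Fin n)
    (w : MvPolynomial (Fin n) ℝ) (u : compactDistributions 𝕜 n) :
    ∑ π : Equiv.Perm (Fin j), altDeriv k₀ (i ∘ π) (fun k => weightTransform k w u) =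
      (j.factorial : ℝ) • weightTransform k₀ (iterPderiv i w) u := by
  -- The offset must vary: the x-derivative term uses the inductive hypothesis at k₀ + 1.
  induction j generalizing k₀ with
  | zero => simp [altDeriv, mixedDeriv, iterPderiv_zero]
  | succ j ih =>
    have h (p : Fin (j + 1)) : MvPolynomial.pderiv (i p)
        (iterPderiv (fun t : Fin j => i (Equiv.swap 0 p t.succ)) w) = iterPderiv i w := by
      rw [← iterPderiv_comp_perm i (Equiv.swap 0 p), iterPderiv_succ (i ∘ _)]
      simp [Fin.tail_def]
    rw [sum_perm_altDeriv_succ]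
    have h' (p : Fin (j + 1)) : ∂_{((0 : Rn n), stdVec (i p))} ((j.factorial : ℝ) •
          weightTransform k₀ (iterPderiv (fun t : Fin j => i (Equiv.swap 0 p t.succ)) w) u)
        - ∂_{(stdVec (i p), (0 : Rn n))} ((j.factorial : ℝ) •
          weightTransform (k₀ + 1) (iterPderiv (fun t : Fin j => i (Equiv.swap 0 p t.succ)) w) u) =
        (j.factorial : ℝ) • weightTransform k₀ (iterPderiv i w) u := by
      rw [← h p, ← weightTransform_pderiv, LineDeriv.lineDerivOp_smul, LineDeriv.lineDerivOp_smul]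
      module
    simp only [ih, h']
    rw [Finset.sum_const, Finset.card_univ, Fintype.card_fin, ← Nat.cast_smul_eq_nsmul ℝ, smul_smul,
      Nat.factorial_succ, Nat.cast_mul]

end AlternatingDerivative

/-! ### The reconstruction formula (a) -/

section Reconstruction

variable {𝕜 : Type*} [RCLike 𝕜] {n m : ℕ}

lemma momentRay_scalarTensor (u : compactDistributions 𝕜 n) :
    momentRay 0 (scalarTensor u) = weightTransform 0 1 u := by
  rw [momentRay, Fintype.sum_unique, componentTransform_eq]
  simp [scalarTensor]

lemma genMomentRay_eq (k : ℕ) (F : TensorSums 𝕜 n m) :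
    genMomentRay k F = ∑ p : Fin (m + 1), ∑ I : Fin p → Fin n,
      weightTransform k (∏ s, MvPolynomial.X (I s)) ((F p).1 I) := by
  simp only [genMomentRay, momentRay, componentTransform_eq]

/-- Each permutation π selects the single multi-index i ∘ π⁻¹, whose component equals that of i by
symmetry, so every one of the j! permutations contributes equally. -/
lemma sum_weightTransform_iterPderiv {j : ℕ} (f : symTensors 𝕜 n j) (i : Fin j → Fin n) :
    ∑ I : Fin j → Fin n, weightTransform 0 (iterPderiv i (∏ s, MvPolynomial.X (I s))) (f.1 I) =
      (j.factorial : ℝ) • weightTransform 0 1 (f.1 i) := by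
  simp only [iterPderiv_prod_X, weightTransform_sum]
  rw [Finset.sum_comm]
  have h (π : Equiv.Perm (Fin j)) : ∑ I : Fin j → Fin n,
      weightTransform 0 (if I ∘ π = i then 1 else 0) (f.1 I) = weightTransform 0 1 (f.1 i) := by
    rw [Finset.sum_eq_single (i ∘ π.symm)]
    · rw [if_pos (by ext; simp), f.2]
    · intro I _ hI
      rw [if_neg, weightTransform_zero]
      rintro rfl
      exact hI (by ext; simp)
    · simp
  simp only [h]
  rw [Finset.sum_const, Finset.card_univ, Fintype.card_perm, Fintype.card_fin,
    ← Nat.cast_smul_eq_nsmul ℝ]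

lemma prod_range_neg_one_sub (r : ℕ) :
    ∏ s ∈ Finset.range r, ((-1 : ℝ) - s) = (-1) ^ r * r.factorial := by
  induction r with
  | zero => simp
  | succ r ih =>
    rw [Finset.prod_range_succ, ih, Nat.factorial_succ]
    push_cast
    ring

/-- The degree of homogeneity p - j - 1 lies in {0, …, m - j - 1}, so one factor of the falling
factorial is zero. -/
lemma eulerOp_weightTransform_of_gt {j p : ℕ} (hjp : j < p) (hpm : p ≤ m) (i : Fin j → Fin n)
    (I : Fin p → Fin n) (u : compactDistributions 𝕜 n) :
    eulerOp (m - j) (weightTransform 0 (iterPderiv i (∏ s, MvPolynomial.X (I s))) u) = 0 := by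
  rw [eulerOp_eq_smul (eulerField_weightTransform
    (isHomogeneous_iterPderiv i (isHomogeneous_prod_X I)) u),
    Finset.prod_eq_zero (i := p - j - 1) (Finset.mem_range.2 (by omega)), distribution_zero_smul]
  rw [Nat.cast_sub (by omega : 1 ≤ p - j), Nat.cast_one, sub_self]

/-- Here the weight is constant, so the transform has degree -1 in ξ. -/
lemma eulerOp_weightTransform_of_eq {j : ℕ} (r : ℕ) (i I : Fin j → Fin n)
    (u : compactDistributions 𝕜 n) :
    eulerOp r (weightTransform 0 (iterPderiv i (∏ s, MvPolynomial.X (I s))) u) =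
      ((-1 : ℝ) ^ r * r.factorial) •
        weightTransform 0 (iterPderiv i (∏ s, MvPolynomial.X (I s))) u := by
  rw [eulerOp_eq_smul (eulerField_weightTransform
    (isHomogeneous_iterPderiv i (isHomogeneous_prod_X I)) u), ← prod_range_neg_one_sub,
    Nat.sub_self, Nat.cast_zero, zero_sub]

/-- The reconstruction formula for the ray transforms of the components of `F` from its generalized
momentum ray transforms. -/
theorem momentRay_component_eq (F : TensorSums 𝕜 n m) (j : ℕ) (hj : j ≤ m) (i : Fin j → Fin n) :
    momentRay 0 (scalarTensor ((F ⟨j, Nat.lt_succ_of_le hj⟩).1 i)) =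
      ((-1 : ℝ) ^ (m - j) / ((m - j).factorial * j.factorial)) •
        symmetrize (fun i' : Fin j → Fin n =>
          eulerOp (m - j) (∑ k ∈ Finset.range (j + 1),
            ((-1 : ℝ) ^ k * (j.choose k : ℝ)) • mixedDeriv k i' (genMomentRay k F))) i := by
  have hsum (i' : Fin j → Fin n) : ∑ k ∈ Finset.range (j + 1),
      ((-1 : ℝ) ^ k * (j.choose k : ℝ)) • mixedDeriv k i' (genMomentRay k F) =
      ∑ p : Fin (m + 1), ∑ I : Fin p → Fin n,
        altDeriv 0 i' fun k => weightTransform k (∏ s, MvPolynomial.X (I s)) ((F p).1 I) := by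
    simp only [← altDeriv_sum, ← genMomentRay_eq]
    simp only [altDeriv, zero_add]
  have hperm : ∑ π : Equiv.Perm (Fin j), ∑ p : Fin (m + 1), ∑ I : Fin p → Fin n,
      altDeriv 0 (i ∘ π) (fun k => weightTransform k (∏ s, MvPolynomial.X (I s)) ((F p).1 I)) =
      (j.factorial : ℝ) • ∑ p : Fin (m + 1), ∑ I : Fin p → Fin n,
        weightTransform 0 (iterPderiv i (∏ s, MvPolynomial.X (I s))) ((F p).1 I) := by
    rw [Finset.sum_comm, Finset.smul_sum]
    refine Finset.sum_congr rfl fun p _ => ?_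
    rw [Finset.sum_comm, Finset.smul_sum]
    exact Finset.sum_congr rfl fun I _ => sum_perm_altDeriv_weightTransform 0 i _ _
  have heuler : eulerOp (m - j) (∑ p : Fin (m + 1), ∑ I : Fin p → Fin n,
      weightTransform 0 (iterPderiv i (∏ s, MvPolynomial.X (I s))) ((F p).1 I)) =
      ((-1 : ℝ) ^ (m - j) * (m - j).factorial * j.factorial) •
        weightTransform 0 1 ((F ⟨j, Nat.lt_succ_of_le hj⟩).1 i) := by
    rw [eulerOp_sum, Finset.sum_eq_single ⟨j, Nat.lt_succ_of_le hj⟩]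
    · rw [eulerOp_sum]
      simp only [eulerOp_weightTransform_of_eq]
      rw [← Finset.smul_sum, sum_weightTransform_iterPderiv, smul_smul]
    · intro p _ hp
      rw [eulerOp_sum]
      refine Finset.sum_eq_zero fun I _ => ?_
      have hp' : (p : ℕ) ≠ j := fun h => hp (Fin.ext h)
      rcases lt_or_gt_of_ne hp' with h | h
      · rw [iterPderiv_eq_zero i (isHomogeneous_prod_X I) h, weightTransform_zero,
          eulerOp_zero]
      · exact eulerOp_weightTransform_of_gt h (Nat.lt_succ_iff.1 p.2) i I _
    · simp
  simp only [symmetrize, hsum]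
  -- P_{m-j} is linear, so it may be applied after the sum over permutations.
  rw [← eulerOp_sum, hperm, eulerOp_smul, heuler, momentRay_scalarTensor, smul_smul, smul_smul,
    smul_smul]
  have h1 : ((m - j).factorial : ℝ) ≠ 0 := by positivity
  have h2 : (j.factorial : ℝ) ≠ 0 := by positivity
  have h3 : ((-1 : ℝ) ^ (m - j)) * (-1) ^ (m - j) = 1 := by
    rw [← mul_pow]; simp
  have : (-1 : ℝ) ^ (m - j) / ((m - j).factorial * j.factorial) * (j.factorial : ℝ)⁻¹ * j.factorial *
      ((-1) ^ (m - j) * (m - j).factorial * j.factorial) = 1 := by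
    field_simp
    rw [sq, h3]
  rw [this, one_smul]

end Reconstruction

/-! ### Compactly supported distributions as functionals on jets -/

section Jets

variable {𝕜 : Type*} [RCLike 𝕜] {n : ℕ}

/-- The normed space of `l`-linear forms on `ℝⁿ`. -/
def MultilinearForms (n l : ℕ) : Type := ContinuousMultilinearMap ℝ (fun _ : Fin l => Rn n) ℝ

instance (n l : ℕ) : NormedAddCommGroup (MultilinearForms n l) :=
  inferInstanceAs (NormedAddCommGroup (ContinuousMultilinearMap ℝ (fun _ : Fin l => Rn n) ℝ))

instance (n l : ℕ) : NormedSpace ℝ (MultilinearForms n l) :=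
  inferInstanceAs (NormedSpace ℝ (ContinuousMultilinearMap ℝ (fun _ : Fin l => Rn n) ℝ))

instance (n l : ℕ) : CompleteSpace (MultilinearForms n l) :=
  inferInstanceAs (CompleteSpace (ContinuousMultilinearMap ℝ (fun _ : Fin l => Rn n) ℝ))

/-- The Banach space of families of continuous functions on `K` in which the derivatives of order
at most `N` of smooth functions lie. -/
abbrev JetSpace (n N : ℕ) (K : Set (Rn n)) : Type :=
  (l : Fin (N + 1)) → C(K, MultilinearForms n l)

/-- The `l`-th derivative of a function as a map to the normed space of `l`-linear forms. -/
def formDeriv (l : ℕ) (φ : Rn n → ℝ) (x : Rn n) : MultilinearForms n l := iteratedFDeriv ℝ l φ x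

lemma smoothFunctions_contDiff (φ : smoothFunctions n) : ContDiff ℝ ∞ (φ : Rn n → ℝ) := φ.2

lemma continuous_formDeriv (l : ℕ) (φ : smoothFunctions n) :
    Continuous (formDeriv l (φ : Rn n → ℝ)) :=
  (smoothFunctions_contDiff φ).continuous_iteratedFDeriv (m := l) (by exact_mod_cast le_top)

/-- The derivatives of order at most `N` on `K` of a smooth function. -/
def jet (N : ℕ) (K : Set (Rn n)) : smoothFunctions n →ₗ[ℝ] JetSpace n N K where
  toFun φ l := ⟨fun x => formDeriv l (φ : Rn n → ℝ) x,
    (continuous_formDeriv l φ).comp continuous_subtype_val⟩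
  map_add' φ ψ := by
    funext l
    ext1 x
    have hφ : ContDiff ℝ l (φ : Rn n → ℝ) :=
      (smoothFunctions_contDiff φ).of_le (by exact_mod_cast le_top)
    have hψ : ContDiff ℝ l (ψ : Rn n → ℝ) :=
      (smoothFunctions_contDiff ψ).of_le (by exact_mod_cast le_top)
    exact iteratedFDeriv_add_apply hφ.contDiffAt hψ.contDiffAt
  map_smul' c φ := by
    funext l
    ext1 x
    have hφ : ContDiff ℝ l (φ : Rn n → ℝ) :=
      (smoothFunctions_contDiff φ).of_le (by exact_mod_cast le_top)
    exact iteratedFDeriv_const_smul_apply hφ.contDiffAt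

lemma jet_apply (N : ℕ) (K : Set (Rn n)) (φ : smoothFunctions n) (l : Fin (N + 1)) (x : K) :
    jet N K φ l x = formDeriv l (φ : Rn n → ℝ) x := rfl

/-- A compactly supported distribution is a continuous functional of finitely many derivatives on
a compact set. -/
lemma exists_jet_functional (u : compactDistributions 𝕜 n) :
    ∃ K : Set (Rn n), ∃ _ : CompactSpace K, ∃ (N : ℕ) (U : JetSpace n N K →L[ℝ] 𝕜),
      ∀ φ, u.1 φ = U (jet N K φ) := by
  obtain ⟨K, hK, N, C, hC⟩ := u.2
  have : CompactSpace K := isCompact_iff_compactSpace.1 hK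
  have hb (φ : smoothFunctions n) : ‖u.1 φ‖ ≤ C * ‖jet N K φ‖ := by
    refine hC φ _ (norm_nonneg _) fun l hl x hx => ?_
    exact ((jet N K φ ⟨l, Nat.lt_succ_of_le hl⟩).norm_coe_le_norm ⟨x, hx⟩).trans
      (norm_le_pi_norm (jet N K φ) ⟨l, Nat.lt_succ_of_le hl⟩)
  -- The seminorm estimate makes `u` vanish on functions with zero jet, so it descends to a bounded
  -- functional on the space of jets.
  have hker : LinearMap.ker (jet N K) ≤ LinearMap.ker u.1 := fun φ hφ => by
    have := hb φ
    rw [LinearMap.mem_ker.1 hφ, norm_zero, mul_zero] at this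
    exact norm_le_zero_iff.1 this
  let f : LinearMap.range (jet (n := n) N K) →ₗ[ℝ] 𝕜 :=
    (LinearMap.ker (jet N K)).liftQ u.1 hker ∘ₗ (jet (n := n) N K).quotKerEquivRange.symm.toLinearMap
  have hf (φ : smoothFunctions n) : f ⟨jet N K φ, LinearMap.mem_range_self _ φ⟩ = u.1 φ := by
    have : (jet (n := n) N K).quotKerEquivRange.symm ⟨jet N K φ, LinearMap.mem_range_self _ φ⟩ =
        Submodule.Quotient.mk φ := (LinearEquiv.symm_apply_eq _).2 rfl
    change (LinearMap.ker (jet N K)).liftQ u.1 hker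
      ((jet (n := n) N K).quotKerEquivRange.symm ⟨jet N K φ, LinearMap.mem_range_self _ φ⟩) = _
    rw [this]
    rfl
  have hfb (y : LinearMap.range (jet (n := n) N K)) : ‖f y‖ ≤ C * ‖y‖ := by
    obtain ⟨_, φ, rfl⟩ := y
    rw [hf]
    exact hb φ
  -- The values lie in 𝕜, which is finite-dimensional over ℝ, so the Hahn–Banach extension to the
  -- whole Banach space applies.
  have : FiniteDimensional ℝ (f.mkContinuous C hfb).toLinearMap.range :=
    FiniteDimensional.finiteDimensional_submodule _
  obtain ⟨U, hU⟩ := (f.mkContinuous C hfb).exist_extension_of_finiteDimensional_range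
  refine ⟨K, isCompact_iff_compactSpace.1 hK, N, U, fun φ => ?_⟩
  rw [← hf]
  exact congrArg (fun g : LinearMap.range (jet (n := n) N K) →L[ℝ] 𝕜 =>
    g ⟨jet N K φ, LinearMap.mem_range_self _ φ⟩) hU

/-- A compactly supported distribution only depends on a neighbourhood of its support. -/
lemma exists_ball_local (u : compactDistributions 𝕜 n) :
    ∃ R : ℝ, 0 < R ∧ ∀ φ ψ : smoothFunctions n,
      (∀ x, ‖x‖ < R → (φ : Rn n → ℝ) x = (ψ : Rn n → ℝ) x) → u.1 φ = u.1 ψ := by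
  obtain ⟨K, hK, N, C, hC⟩ := u.2
  obtain ⟨R, hR⟩ := hK.isBounded.exists_norm_le
  refine ⟨|R| + 1, by positivity, fun φ ψ h => ?_⟩
  -- The defining estimate is used with M = 0: the open ball contains K, so φ - ψ vanishes near
  -- every point of K together with its derivatives.
  rw [← sub_eq_zero, ← map_sub, ← norm_le_zero_iff, ← mul_zero C]
  refine hC _ _ le_rfl fun l _ x hx => ?_
  have hx' : ‖x‖ < |R| + 1 := (hR x hx).trans_lt ((le_abs_self R).trans_lt (lt_add_one _))
  have h0 : ((φ - ψ : smoothFunctions n) : Rn n → ℝ) =ᶠ[nhds x] fun _ => 0 := by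
    filter_upwards [(isOpen_lt continuous_norm continuous_const).mem_nhds hx'] with y hy
    exact sub_eq_zero.2 (h y hy)
  rw [(h0.iteratedFDeriv ℝ l).self_of_nhds]
  simp

end Jets

/-! ### Plane waves and Fourier integrals under a distribution -/

section PlaneWaves

open VectorFourier Real
open scoped FourierTransform

variable {𝕜 : Type*} [RCLike 𝕜] {n : ℕ}
lemma integrable_dirac_moment {V : Type} [NormedAddCommGroup V] [MeasurableSpace V] [BorelSpace V]
    (f : V → ℂ) (v : V) (l : ℕ) :
    Integrable (fun y => ‖y‖ ^ l * ‖f y‖) (Measure.dirac v) :=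
  integrable_dirac (by simp [← enorm_norm])

variable {V : Type} [NormedAddCommGroup V] [NormedSpace ℝ V] [MeasurableSpace V] [BorelSpace V]
  [SecondCountableTopology V]

/-- Viewing a single wave as the Fourier integral of a Dirac mass yields its smoothness and its
derivatives from the general theory of Fourier integrals. -/
lemma fourierIntegral_dirac (L : V →L[ℝ] Rn n →L[ℝ] ℝ) (f : V → ℂ) (v : V) :
    fourierIntegral 𝐞 (Measure.dirac v) L.toLinearMap₁₂ f = fun x => 𝐞 (-L v x) • f v := by
  ext x
  simp [fourierIntegral, integral_dirac]

lemma contDiff_wave (L : V →L[ℝ] Rn n →L[ℝ] ℝ) (f : V → ℂ) (v : V) :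
    ContDiff ℝ ∞ fun x => 𝐞 (-L v x) • f v := by
  rw [← fourierIntegral_dirac]
  exact contDiff_fourierIntegral L fun l _ => integrable_dirac_moment f v l

lemma iteratedFDeriv_wave (L : V →L[ℝ] Rn n →L[ℝ] ℝ) (f : V → ℂ) (v : V) (l : ℕ) (x : Rn n) :
    iteratedFDeriv ℝ l (fun x => 𝐞 (-L v x) • f v) x =
      𝐞 (-L v x) • fourierPowSMulRight L f v l := by
  rw [← fourierIntegral_dirac, iteratedFDeriv_fourierIntegral (N := ⊤) L
    (fun l _ => integrable_dirac_moment f v l) aestronglyMeasurable_dirac le_top]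
  simp [fourierIntegral, integral_dirac]

/-- The real part of `f(v) e^{-2πi L(v, x)}` as a function of `x`. -/
def waveRe (L : V →L[ℝ] Rn n →L[ℝ] ℝ) (f : V → ℂ) (v : V) : smoothFunctions n :=
  ⟨fun x => (𝐞 (-L v x) • f v).re, Complex.reCLM.contDiff.comp (contDiff_wave L f v)⟩

/-- The real part of the Fourier transform of `f`, for `f` with all moments finite. -/
def fourierRe (L : V →L[ℝ] Rn n →L[ℝ] ℝ) (μ : Measure V) (f : V → ℂ)
    (hf : ∀ l : ℕ, Integrable (fun v => ‖v‖ ^ l * ‖f v‖) μ) : smoothFunctions n :=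
  ⟨fun x => (fourierIntegral 𝐞 μ L.toLinearMap₁₂ f x).re,
    Complex.reCLM.contDiff.comp (contDiff_fourierIntegral (N := ⊤) L fun l _ => hf l)⟩

/-- Taking real parts of multilinear maps. -/
def reMultilinear (n l : ℕ) : ContinuousMultilinearMap ℝ (fun _ : Fin l => Rn n) ℂ →L[ℝ]
    MultilinearForms n l :=
  ContinuousLinearMap.compContinuousMultilinearMapL ℝ (fun _ : Fin l => Rn n) ℂ ℝ Complex.reCLM

lemma jet_waveRe (N : ℕ) (K : Set (Rn n)) (L : V →L[ℝ] Rn n →L[ℝ] ℝ) (f : V → ℂ) (v : V)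
    (l : Fin (N + 1)) (x : K) :
    jet N K (waveRe L f v) l x = reMultilinear n l (𝐞 (-L v x) • fourierPowSMulRight L f v l) := by
  rw [← iteratedFDeriv_wave, jet_apply]
  exact Complex.reCLM.iteratedFDeriv_comp_left (contDiff_wave L f v).contDiffAt
    (by exact_mod_cast le_top)

lemma continuous_jet_waveRe (N : ℕ) (K : Set (Rn n)) (L : V →L[ℝ] Rn n →L[ℝ] ℝ) {f : V → ℂ}
    (hf : Continuous f) : Continuous fun v => jet N K (waveRe L f v) := by
  refine continuous_pi fun l => ContinuousMap.continuous_of_continuous_uncurry _ ?_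
  simp only [Function.uncurry_def, jet_waveRe]
  refine (reMultilinear n l).continuous.comp (Continuous.smul ?_ ?_)
  · exact (continuous_subtype_val : Continuous fun z : Circle => (z : ℂ)).comp <|
      Real.continuous_fourierChar.comp ((L.continuous.comp continuous_fst).clm_apply
        (continuous_subtype_val.comp continuous_snd)).neg
  · exact (hf.fourierPowSMulRight L l).comp continuous_fst

/-- Each derivative of a wave costs a factor 2π‖L‖‖v‖, so finite moments of `f` make the jet-valued
map Bochner integrable. -/
lemma norm_jet_waveRe_le (N : ℕ) (K : Set (Rn n)) [CompactSpace K] (L : V →L[ℝ] Rn n →L[ℝ] ℝ)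
    (f : V → ℂ) (v : V) :
    ‖jet N K (waveRe L f v)‖ ≤ ∑ l : Fin (N + 1),
      ‖reMultilinear n l‖ * (2 * π * ‖L‖) ^ (l : ℕ) * (‖v‖ ^ (l : ℕ) * ‖f v‖) := by
  refine (pi_norm_le_iff_of_nonneg (by positivity)).2 fun l => ?_
  refine le_trans ?_ (Finset.single_le_sum (fun l _ => by positivity) (Finset.mem_univ l))
  refine (ContinuousMap.norm_le _ (by positivity)).2 fun x => ?_
  rw [jet_waveRe, mul_assoc, ← mul_assoc (_ ^ _)]
  refine ((reMultilinear n l).le_opNorm _).trans ?_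
  gcongr
  refine (Circle.norm_smul (E := ContinuousMultilinearMap ℝ (fun _ : Fin l => Rn n) ℂ)
    _ _).trans_le ?_
  exact norm_fourierPowSMulRight_le L f v l

lemma integrable_jet_waveRe (N : ℕ) (K : Set (Rn n)) [CompactSpace K]
    (L : V →L[ℝ] Rn n →L[ℝ] ℝ) {μ : Measure V} {f : V → ℂ} (hf : Continuous f)
    (hI : ∀ l : ℕ, Integrable (fun v => ‖v‖ ^ l * ‖f v‖) μ) :
    Integrable (fun v => jet N K (waveRe L f v)) μ :=
  Integrable.mono' (integrable_finsetSum Finset.univ fun (l : Fin (N + 1)) _ =>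
      (hI l).const_mul (‖reMultilinear n l‖ * (2 * π * ‖L‖) ^ (l : ℕ)))
    (continuous_jet_waveRe N K L hf).aestronglyMeasurable
    (.of_forall fun v => norm_jet_waveRe_le N K L f v)

/-- Evaluation of a jet at an order and a point is continuous and commutes with the Bochner
integral, which reduces the claim to differentiation under the Fourier integral. -/
lemma jet_fourierRe (N : ℕ) (K : Set (Rn n)) [CompactSpace K]
    (L : V →L[ℝ] Rn n →L[ℝ] ℝ) {μ : Measure V} {f : V → ℂ} (hf : Continuous f)
    (hI : ∀ l : ℕ, Integrable (fun v => ‖v‖ ^ l * ‖f v‖) μ) :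
    jet N K (fourierRe L μ f hI) = ∫ v, jet N K (waveRe L f v) ∂μ := by
  funext l
  ext1 x
  have h1 := ((ContinuousMap.evalCLM ℝ x).comp (ContinuousLinearMap.proj (R := ℝ)
    (φ := fun l : Fin (N + 1) => C(K, MultilinearForms n l))
    l)).integral_comp_comm (integrable_jet_waveRe N K L hf hI)
  have h2 : (∫ v, jet N K (waveRe L f v) ∂μ) l x = ∫ v, jet N K (waveRe L f v) l x ∂μ := h1.symm
  have h3 : Integrable (fun v => 𝐞 (-L v x) • fourierPowSMulRight L f v l) μ := by
    refine Integrable.mono' ((hI l).const_mul ((2 * π * ‖L‖) ^ (l : ℕ)))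
      (Continuous.aestronglyMeasurable ?_) (.of_forall fun v => ?_)
    · exact (Real.continuous_fourierChar.comp (by fun_prop)).smul (hf.fourierPowSMulRight L l)
    · refine (Circle.norm_smul (E := ContinuousMultilinearMap ℝ (fun _ : Fin l => Rn n) ℂ)
    _ _).trans_le ?_
      rw [← mul_assoc]
      exact norm_fourierPowSMulRight_le L f v l
  rw [h2]
  simp only [jet_waveRe]
  rw [(reMultilinear n l).integral_comp_comm h3, jet_apply]
  have h4 := congrFun (iteratedFDeriv_fourierIntegral (N := ⊤) (n := (l : ℕ)) L (fun l _ => hI l)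
    (hf.aestronglyMeasurable (μ := μ)) le_top) (x : Rn n)
  have h5 : formDeriv l (fourierRe L μ f hI : Rn n → ℝ) x = reMultilinear n l
      (iteratedFDeriv ℝ l (fourierIntegral 𝐞 μ L.toLinearMap₁₂ f) x) :=
    Complex.reCLM.iteratedFDeriv_comp_left
      (contDiff_fourierIntegral (N := ⊤) L fun l _ => hI l).contDiffAt (by exact_mod_cast le_top)
  rw [h5, h4]
  rfl

/-- A compactly supported distribution commutes with the Fourier integral. -/
lemma apply_fourierRe (u : compactDistributions 𝕜 n) (L : V →L[ℝ] Rn n →L[ℝ] ℝ) {μ : Measure V}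
    {f : V → ℂ} (hf : Continuous f) (hI : ∀ l : ℕ, Integrable (fun v => ‖v‖ ^ l * ‖f v‖) μ) :
    u.1 (fourierRe L μ f hI) = ∫ v, u.1 (waveRe L f v) ∂μ := by
  obtain ⟨K, _, N, U, hU⟩ := exists_jet_functional u
  simp only [hU]
  rw [jet_fourierRe N K L hf hI, U.integral_comp_comm (integrable_jet_waveRe N K L hf hI)]

lemma continuous_apply_waveRe (u : compactDistributions 𝕜 n) (L : V →L[ℝ] Rn n →L[ℝ] ℝ)
    {f : V → ℂ} (hf : Continuous f) : Continuous fun v => u.1 (waveRe L f v) := by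
  obtain ⟨K, _, N, U, hU⟩ := exists_jet_functional u
  simp only [hU]
  exact U.continuous.comp (continuous_jet_waveRe N K L hf)

end PlaneWaves

/-! ### Injectivity of the ray transform in dimension at least two -/

section Injectivity

open VectorFourier Real
open scoped FourierTransform InnerProductSpace

variable {𝕜 : Type*} [RCLike 𝕜] {n : ℕ}

/-- A smooth bump function on `ℝ` with integral `1`, supported in `[-2, 2]`. -/
def unitBump : ℝ → ℝ := (⟨1, 2, one_pos, one_lt_two⟩ : ContDiffBump (0 : ℝ)).normed volume

lemma unitBump_contDiff : ContDiff ℝ ∞ unitBump := ContDiffBump.contDiff_normed _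

lemma integral_unitBump : ∫ t, unitBump t = 1 := ContDiffBump.integral_normed _

lemma abs_lt_of_unitBump_ne_zero {t : ℝ} (h : unitBump t ≠ 0) : |t| < 2 := by
  have : t ∈ Function.support unitBump := h
  rw [unitBump, ContDiffBump.support_normed_eq] at this
  simpa using this

/-- Integrating along a line with the weight `‖ξ‖² unitBump ⟪x, ξ⟫` recovers functions constant
along that line. -/
lemma integral_unitBump_line (x : Rn n) {ξ : Rn n} (hξ : ξ ≠ 0) :
    ∫ t : ℝ, ‖ξ‖ ^ 2 * unitBump ⟪x - t • ξ, ξ⟫_ℝ = 1 := by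
  have h0 : ‖ξ‖ ^ 2 ≠ 0 := by positivity
  have h (t : ℝ) : ⟪x - t • ξ, ξ⟫_ℝ = ⟪x, ξ⟫_ℝ - ‖ξ‖ ^ 2 * t := by
    rw [inner_sub_left, inner_smul_left, real_inner_self_eq_norm_sq]
    simp [mul_comm]
  simp only [h]
  rw [integral_const_mul, Measure.integral_comp_mul_left (fun s => unitBump (⟪x, ξ⟫_ℝ - s)),
    integral_sub_left_eq_self, integral_unitBump, smul_eq_mul, mul_one,
    abs_of_nonneg (by positivity), mul_inv_cancel₀ h0]

/-- A cut-off function on `ℝⁿ` equal to `1` on the ball of radius `R`. -/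
def ballCutoff (n : ℕ) {R : ℝ} (hR : 0 < R) : ContDiffBump (0 : Rn n) :=
  ⟨R, R + 1, hR, lt_add_one R⟩

/-- The test function `Re(c e^{-2πi L(ξ, x)}) χ(ξ) ‖ξ‖² unitBump ⟪x, ξ⟫` cut off in `x`. -/
def lineWave (L : Rn n →L[ℝ] Rn n →L[ℝ] ℝ) (c : ℂ) (χ : Rn n → ℝ) {R : ℝ} (hR : 0 < R)
    (q : Rn n × Rn n) : ℝ :=
  (𝐞 (-L q.2 q.1) • ((χ q.2 : ℂ) * c)).re * (‖q.2‖ ^ 2 * unitBump ⟪q.1, q.2⟫_ℝ) *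
    ballCutoff n hR q.1

lemma lineWave_contDiff (L : Rn n →L[ℝ] Rn n →L[ℝ] ℝ) (c : ℂ) {χ : Rn n → ℝ}
    (hχ : ContDiff ℝ ∞ χ) {R : ℝ} (hR : 0 < R) : ContDiff ℝ ∞ (lineWave L c χ hR) := by
  have h1 : ContDiff ℝ ∞ fun q : Rn n × Rn n => (𝐞 (-L q.2 q.1) : ℂ) := by
    simp only [Real.fourierChar_apply]
    have : ContDiff ℝ ∞ fun q : Rn n × Rn n => L q.2 q.1 := by fun_prop
    have h2 : ContDiff ℝ ∞ fun q : Rn n × Rn n => ((2 * π * -L q.2 q.1 : ℝ) : ℂ) :=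
      Complex.ofRealCLM.contDiff.comp (contDiff_const.mul this.neg)
    exact (h2.mul contDiff_const).cexp
  have h2 : ContDiff ℝ ∞ fun q : Rn n × Rn n => ((χ q.2 : ℂ) * c) :=
    (Complex.ofRealCLM.contDiff.comp (hχ.comp contDiff_snd)).mul contDiff_const
  have h3 : ContDiff ℝ ∞ fun q : Rn n × Rn n => (𝐞 (-L q.2 q.1) • ((χ q.2 : ℂ) * c)).re :=
    Complex.reCLM.contDiff.comp (h1.mul h2)
  have h4 : ContDiff ℝ ∞ fun q : Rn n × Rn n => ‖q.2‖ ^ 2 * unitBump ⟪q.1, q.2⟫_ℝ :=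
    (contDiff_snd.norm_sq ℝ).mul (unitBump_contDiff.comp (contDiff_fst.inner ℝ contDiff_snd))
  exact (h3.mul h4).mul ((ballCutoff n hR).contDiff.comp contDiff_fst)

lemma lineWave_eq_zero (L : Rn n →L[ℝ] Rn n →L[ℝ] ℝ) (c : ℂ) (χ : Rn n → ℝ) {R : ℝ} (hR : 0 < R)
    {q : Rn n × Rn n} (hq : q ∉ Metric.closedBall (0 : Rn n) (R + 1) ×ˢ tsupport χ) :
    lineWave L c χ hR q = 0 := by
  rw [Set.mem_prod, not_and_or] at hq
  rcases hq with h | h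
  · have : ballCutoff n hR q.1 = 0 := by
      refine (ballCutoff n hR).zero_of_le_dist ?_
      rw [Metric.mem_closedBall, not_le] at h
      exact h.le
    rw [lineWave, this, mul_zero]
  · simp [lineWave, image_eq_zero_of_notMem_tsupport h]

/-- `lineWave` as a test function on the phase space. -/
def lineWaveTest (L : Rn n →L[ℝ] Rn n →L[ℝ] ℝ) (c : ℂ) {χ : Rn n → ℝ} (hχ : ContDiff ℝ ∞ χ)
    (hc : HasCompactSupport χ) (h0 : tsupport χ ⊆ {0}ᶜ) {R : ℝ} (hR : 0 < R) :
    𝓓(phaseSpace n, ℝ) where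
  toFun := lineWave L c χ hR
  contDiff' := lineWave_contDiff L c hχ hR
  hasCompactSupport' := HasCompactSupport.intro ((isCompact_closedBall _ _).prod hc)
    fun _ => lineWave_eq_zero L c χ hR
  tsupport_subset' := by
    have h1 : tsupport (lineWave L c χ hR) ⊆ Metric.closedBall (0 : Rn n) (R + 1) ×ˢ tsupport χ :=
      closure_minimal (fun q hq => by_contra fun h => hq (lineWave_eq_zero L c χ hR h))
        (Metric.isClosed_closedBall.prod (isClosed_tsupport χ))
    exact fun q hq => h0 (h1 hq).2

/-- On the support of χ one has ‖ξ‖ ≥ δ > 0, so |⟪x - tξ, ξ⟫| < 2 bounds |t|‖ξ‖ by |R| + 2/δ. With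
this radius the cut-off in x is invisible in the line integrals through the ball of radius R. -/
lemma exists_radius {χ : Rn n → ℝ} (hc : HasCompactSupport χ) (h0 : tsupport χ ⊆ {0}ᶜ) (R : ℝ) :
    ∃ R' : ℝ, 0 < R' ∧ ∀ x ξ : Rn n, ∀ t : ℝ, ‖x‖ < R → χ ξ ≠ 0 →
      unitBump ⟪x - t • ξ, ξ⟫_ℝ ≠ 0 → ‖x - t • ξ‖ ≤ R' := by
  have hpos : ∀ ξ ∈ tsupport χ, (0 : ℝ) < ‖ξ‖ := fun ξ hξ => norm_pos_iff.2 (h0 hξ)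
  obtain ⟨δ, hδ, hδK⟩ := hc.isCompact.exists_forall_le' continuous_norm.continuousOn hpos
  refine ⟨2 * |R| + 2 / δ + 1, by positivity, fun x ξ t hx hξ ht => ?_⟩
  have hξ' : ξ ∈ tsupport χ := subset_tsupport χ hξ
  have hδξ := hδK ξ hξ'
  have hn : 0 < ‖ξ‖ := hpos ξ hξ'
  have h1 := abs_lt_of_unitBump_ne_zero ht
  have h2 : ⟪x - t • ξ, ξ⟫_ℝ = ⟪x, ξ⟫_ℝ - t * ‖ξ‖ ^ 2 := by
    rw [inner_sub_left, inner_smul_left, real_inner_self_eq_norm_sq]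
    simp
  have h3 : |⟪x, ξ⟫_ℝ| ≤ |R| * ‖ξ‖ :=
    (abs_real_inner_le_norm x ξ).trans (by gcongr; exact hx.le.trans (le_abs_self R))
  have h4 : |t| * ‖ξ‖ ^ 2 ≤ |R| * ‖ξ‖ + 2 := by
    rw [h2] at h1
    have : |t * ‖ξ‖ ^ 2| ≤ |⟪x, ξ⟫_ℝ| + |⟪x, ξ⟫_ℝ - t * ‖ξ‖ ^ 2| := by
      have := abs_sub ⟪x, ξ⟫_ℝ (⟪x, ξ⟫_ℝ - t * ‖ξ‖ ^ 2)
      rwa [sub_sub_cancel] at this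
    rw [abs_mul, abs_of_nonneg (by positivity : (0 : ℝ) ≤ ‖ξ‖ ^ 2)] at this
    linarith
  have h5 : |t| * ‖ξ‖ ≤ |R| + 2 / δ := by
    have h6 : |t| * ‖ξ‖ * ‖ξ‖ ≤ (|R| + 2 / δ) * ‖ξ‖ := by
      have : 2 ≤ 2 / δ * ‖ξ‖ := by
        rw [div_mul_eq_mul_div, le_div_iff₀ hδ]
        linarith
      nlinarith
    exact le_of_mul_le_mul_right h6 hn
  calc ‖x - t • ξ‖ ≤ ‖x‖ + ‖t • ξ‖ := norm_sub_le _ _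
    _ = ‖x‖ + |t| * ‖ξ‖ := by rw [norm_smul, Real.norm_eq_abs]
    _ ≤ _ := by linarith [hx.le.trans (le_abs_self R)]

lemma integrable_moment_of_hasCompactSupport {f : Rn n → ℂ} (hf : Continuous f)
    (hc : HasCompactSupport f) (l : ℕ) : Integrable fun v => ‖v‖ ^ l * ‖f v‖ :=
  (by fun_prop : Continuous fun v => ‖v‖ ^ l * ‖f v‖).integrable_of_hasCompactSupport
    (hc.norm.mul_left)

lemma continuous_ofReal_mul {χ : Rn n → ℝ} (hχ : ContDiff ℝ ∞ χ) (c : ℂ) :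
    Continuous fun ξ => (χ ξ : ℂ) * c := by
  have := hχ.continuous
  fun_prop

lemma hasCompactSupport_ofReal_mul {χ : Rn n → ℝ} (hχ : HasCompactSupport χ) (c : ℂ) :
    HasCompactSupport fun ξ => (χ ξ : ℂ) * c :=
  (hχ.comp_left (g := fun r : ℝ => (r : ℂ)) Complex.ofReal_zero).mul_right

/-- Near the origin, the adjoint ray transform of `lineWaveTest` is a Fourier transform. -/
lemma weightAdjoint_lineWaveTest {L : Rn n →L[ℝ] Rn n →L[ℝ] ℝ} (hL : ∀ ξ, L ξ ξ = 0) (c : ℂ)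
    {χ : Rn n → ℝ} (hχ : ContDiff ℝ ∞ χ) (hc : HasCompactSupport χ) (h0 : tsupport χ ⊆ {0}ᶜ)
    {R R' : ℝ} (hR' : 0 < R') (h : ∀ x ξ : Rn n, ∀ t : ℝ, ‖x‖ < R → χ ξ ≠ 0 →
      unitBump ⟪x - t • ξ, ξ⟫_ℝ ≠ 0 → ‖x - t • ξ‖ ≤ R') {x : Rn n} (hx : ‖x‖ < R) :
    (weightAdjoint 0 1 (lineWaveTest L c hχ hc h0 hR') : Rn n → ℝ) x =
      (fourierRe L volume (fun ξ => (χ ξ : ℂ) * c) (integrable_moment_of_hasCompactSupport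
        (continuous_ofReal_mul hχ c) (hasCompactSupport_ofReal_mul hc c)) : Rn n → ℝ) x := by
  have hint : Integrable fun ξ : Rn n => 𝐞 (-L ξ x) • ((χ ξ : ℂ) * c) := by
    refine Continuous.integrable_of_hasCompactSupport ?_ ?_
    · exact (Real.continuous_fourierChar.comp (by fun_prop)).smul (continuous_ofReal_mul hχ c)
    · exact (hasCompactSupport_ofReal_mul hc c).smul_left
  have hre : (∫ ξ : Rn n, 𝐞 (-L ξ x) • ((χ ξ : ℂ) * c)).re =
      ∫ ξ : Rn n, (𝐞 (-L ξ x) • ((χ ξ : ℂ) * c)).re :=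
    (Complex.reCLM.integral_comp_comm hint).symm
  change ∫ ξ : Rn n, ∫ t : ℝ, (t ^ 0 * polyFun 1 ξ) • lineWave L c χ hR' (x - t • ξ, ξ) =
    (∫ ξ : Rn n, 𝐞 (-L ξ x) • ((χ ξ : ℂ) * c)).re
  rw [hre]
  congr 1; ext ξ
  by_cases hξ : χ ξ = 0
  · simp [lineWave, hξ]
  have hξ0 : ξ ≠ 0 := h0 (subset_tsupport χ hξ)
  -- Because L(ξ, ξ) = 0, the wave is constant along the line and leaves the t-integral, while the
  -- cut-off equals 1 wherever the bump is nonzero.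
  have key (t : ℝ) : (t ^ 0 * polyFun 1 ξ) • lineWave L c χ hR' (x - t • ξ, ξ) =
      (𝐞 (-L ξ x) • ((χ ξ : ℂ) * c)).re * (‖ξ‖ ^ 2 * unitBump ⟪x - t • ξ, ξ⟫_ℝ) := by
    have h1 : polyFun (1 : MvPolynomial (Fin n) ℝ) ξ = 1 := map_one _
    have h2 : L ξ (x - t • ξ) = L ξ x := by simp [hL]
    rw [h1, lineWave, h2]
    by_cases hb : unitBump ⟪x - t • ξ, ξ⟫_ℝ = 0
    · simp [hb]
    · have : ballCutoff n hR' (x - t • ξ) = 1 := by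
        refine (ballCutoff n hR').one_of_mem_closedBall ?_
        rw [mem_closedBall_zero_iff]
        exact h x ξ t hx hξ hb
      rw [this]
      simp
  simp only [key]
  rw [integral_const_mul, integral_unitBump_line x hξ0, mul_one]

/-- A distribution with vanishing ray transform annihilates the plane waves which are constant
along some line. -/
lemma apply_waveRe_eq_zero {u : compactDistributions 𝕜 n} (hu : weightTransform 0 1 u = 0)
    {L : Rn n →L[ℝ] Rn n →L[ℝ] ℝ} (hL : ∀ ξ, L ξ ξ = 0) (c : ℂ) {ξ : Rn n} (hξ : ξ ≠ 0) :
    u.1 (waveRe L (fun _ => c) ξ) = 0 := by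
  have hcont : Continuous fun ξ => u.1 (waveRe L (fun _ => c) ξ) :=
    continuous_apply_waveRe u L continuous_const
  obtain ⟨R, -, hloc⟩ := exists_ball_local u
  -- Tested against any χ supported away from 0, ξ ↦ ⟨u, wave_ξ⟩ integrates to ⟨u, Fourier integral⟩
  -- = ⟨u, adjoint of a test function⟩ = 0.
  have hae : ∀ᵐ ξ : Rn n, ξ ∈ ({0}ᶜ : Set (Rn n)) → u.1 (waveRe L (fun _ => c) ξ) = 0 := by
    refine isOpen_compl_singleton.ae_eq_zero_of_integral_contDiff_smul_eq_zero
      (hcont.locallyIntegrable.locallyIntegrableOn _) fun χ hχ hc h0 => ?_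
    obtain ⟨R', hR', h⟩ := exists_radius hc h0 R
    have h1 := apply_fourierRe u L (μ := volume) (continuous_ofReal_mul hχ c)
      (integrable_moment_of_hasCompactSupport
        (continuous_ofReal_mul hχ c) (hasCompactSupport_ofReal_mul hc c))
    have h2 := hloc _ _ fun x hx => weightAdjoint_lineWaveTest hL c hχ hc h0 hR' h hx
    have h3 : u.1 (weightAdjoint 0 1 (lineWaveTest L c hχ hc h0 hR')) = 0 := by
      rw [← weightTransform_apply, hu]
      rfl
    rw [← h2, h3] at h1
    rw [h1]
    congr 1; ext ξ
    rw [← map_smul]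
    congr 1
    ext x
    change χ ξ * (𝐞 (-L ξ x) • c).re = (𝐞 (-L ξ x) • ((χ ξ : ℂ) * c)).re
    rw [Circle.smul_def, Circle.smul_def, smul_eq_mul, smul_eq_mul, mul_left_comm,
      Complex.re_ofReal_mul]
  by_contra hne
  -- From almost everywhere to everywhere: by continuity the exceptional set is open, and an open
  -- null set is empty.
  have hopen : IsOpen ({0}ᶜ ∩ {ξ : Rn n | u.1 (waveRe L (fun _ => c) ξ) ≠ 0}) :=
    isOpen_compl_singleton.inter (isOpen_ne_fun hcont continuous_const)
  have hnull : volume ({0}ᶜ ∩ {ξ : Rn n | u.1 (waveRe L (fun _ => c) ξ) ≠ 0}) = 0 := by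
    rw [ae_iff] at hae
    refine measure_mono_null (fun ξ hξ => ?_) hae
    simpa using hξ
  rw [hopen.measure_eq_zero_iff volume] at hnull
  exact Set.notMem_empty ξ (hnull ▸ ⟨hξ, hne⟩)

/-- The orthogonal complement of the line through η has dimension at least n - 1 ≥ 1; this is where
n ≥ 2 enters. -/
lemma exists_ne_zero_inner_eq_zero (hn : 2 ≤ n) (η : Rn n) : ∃ ξ : Rn n, ξ ≠ 0 ∧ ⟪η, ξ⟫_ℝ = 0 := by
  have h1 : Module.finrank ℝ (ℝ ∙ η)ᗮ ≠ 0 := by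
    have h2 := Submodule.finrank_add_finrank_orthogonal (ℝ ∙ η)
    have h3 : Module.finrank ℝ (ℝ ∙ η) ≤ 1 := by
      simpa using finrank_span_le_card (R := ℝ) ({η} : Set (Rn n))
    rw [finrank_euclideanSpace_fin] at h2
    omega
  have h2 : (ℝ ∙ η)ᗮ ≠ ⊥ := fun h => h1 (by rw [h, finrank_bot])
  obtain ⟨ξ, hξ, hξ0⟩ := Submodule.exists_mem_ne_zero_of_ne_bot h2
  exact ⟨ξ, hξ0, Submodule.mem_orthogonal_singleton_iff_inner_right.1 hξ⟩

lemma apply_planeWave_eq_zero (hn : 2 ≤ n) {u : compactDistributions 𝕜 n}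
    (hu : weightTransform 0 1 u = 0) (f : Rn n → ℂ) (η : Rn n) :
    u.1 (waveRe (innerSL ℝ) f η) = 0 := by
  obtain ⟨ξ, hξ, hηξ⟩ := exists_ne_zero_inner_eq_zero hn η
  -- The normalized wedge of ξ and η: it is alternating, and since η ⟂ ξ it satisfies L(ξ, ·) = ⟪η,
  -- ·⟫, so the wave at ζ = ξ is the plane wave of frequency η.
  let L : Rn n →L[ℝ] Rn n →L[ℝ] ℝ := (‖ξ‖ ^ 2)⁻¹ •
    ((innerSL ℝ ξ).smulRight (innerSL ℝ η) - (innerSL ℝ η).smulRight (innerSL ℝ ξ))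
  have hL (ζ x : Rn n) : L ζ x = (‖ξ‖ ^ 2)⁻¹ * (⟪ξ, ζ⟫_ℝ * ⟪η, x⟫_ℝ - ⟪η, ζ⟫_ℝ * ⟪ξ, x⟫_ℝ) := by
    simp [L]
  have h := apply_waveRe_eq_zero hu (L := L) (fun ζ => by rw [hL]; ring) (f η) hξ
  rw [← h]
  congr 1
  ext x
  have hx : L ξ x = ⟪η, x⟫_ℝ := by
    have : ‖ξ‖ ^ 2 ≠ 0 := by positivity
    rw [hL, hηξ, real_inner_self_eq_norm_sq]
    field_simp
    ring
  change (𝐞 (-⟪η, x⟫_ℝ) • f η).re = (𝐞 (-L ξ x) • f η).re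
  rw [hx]

/-- A compactly supported distribution annihilating all plane waves vanishes. -/
lemma eq_zero_of_planeWave {u : compactDistributions 𝕜 n}
    (hu : ∀ (f : Rn n → ℂ) (η : Rn n), u.1 (waveRe (innerSL ℝ) f η) = 0) : u = 0 := by
  obtain ⟨R, hR, hloc⟩ := exists_ball_local u
  refine Subtype.ext (LinearMap.ext fun φ => ?_)
  have hφ := smoothFunctions_contDiff φ
  have hc : HasCompactSupport fun x => ((ballCutoff n hR x * (φ : Rn n → ℝ) x : ℝ) : ℂ) :=
    ((ballCutoff n hR).hasCompactSupport.mul_right (f' := (φ : Rn n → ℝ))).comp_left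
      (g := fun r : ℝ => (r : ℂ)) Complex.ofReal_zero
  have hs : ContDiff ℝ ∞ fun x => ((ballCutoff n hR x * (φ : Rn n → ℝ) x : ℝ) : ℂ) :=
    Complex.ofRealCLM.contDiff.comp ((ballCutoff n hR).contDiff.mul hφ)
  let Φ : SchwartzMap (Rn n) ℂ := hc.toSchwartzMap hs
  -- The cut-off of φ is Schwartz, so it is the Fourier transform of a function with all moments
  -- finite, that is, a superposition of plane waves; on the ball seen by `u` it agrees with φ.
  let g : SchwartzMap (Rn n) ℂ := 𝓕⁻ Φ
  have hg (l : ℕ) : Integrable (fun v => ‖v‖ ^ l * ‖g v‖) (volume : Measure (Rn n)) :=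
    g.integrable_pow_mul volume l
  have h1 := apply_fourierRe u (innerSL ℝ) (μ := volume) g.continuous hg
  simp only [hu, integral_zero] at h1
  change u.1 φ = 0
  rw [← h1]
  refine hloc _ _ fun x hx => ?_
  have h2 : 𝓕 (g : Rn n → ℂ) x = Φ x := by
    rw [← SchwartzMap.fourier_coe]
    simp [g]
  change _ = (𝓕 (g : Rn n → ℂ) x).re
  have h3 : Φ x = ((ballCutoff n hR x * (φ : Rn n → ℝ) x : ℝ) : ℂ) := rfl
  rw [h2, h3, Complex.ofReal_re,
    (ballCutoff n hR).one_of_mem_closedBall (mem_closedBall_zero_iff.2 hx.le), one_mul]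

/-- The ray transform is injective on compactly supported distributions in dimension at least
two. -/
theorem eq_zero_of_momentRay_eq_zero (hn : 2 ≤ n) {u : compactDistributions 𝕜 n}
    (hu : momentRay 0 (scalarTensor u) = 0) : u = 0 :=
  eq_zero_of_planeWave (apply_planeWave_eq_zero hn ((momentRay_scalarTensor u).symm.trans hu))

end Injectivity

end MomentumRay

end

theorem mainTheorem4 {𝕜 : Type*} [RCLike 𝕜] (n m : ℕ) (F : TensorSums 𝕜 n m) :
    (∀ (j : ℕ) (hj : j ≤ m) (i : Fin j → Fin n),
      momentRay 0 (scalarTensor ((F ⟨j, Nat.lt_succ_of_le hj⟩).1 i)) =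
        ((-1 : ℝ) ^ (m - j) / ((m - j).factorial * j.factorial)) •
          symmetrize (fun i' : Fin j → Fin n =>
            eulerOp (m - j) (∑ k ∈ Finset.range (j + 1),
              ((-1 : ℝ) ^ k * (j.choose k : ℝ)) • mixedDeriv k i' (genMomentRay k F))) i) ∧
    (2 ≤ n → ∀ (k : ℕ) (hk : k < m), (∀ l ≤ k, genMomentRay l F = 0) →
      ∀ (j : ℕ) (hj : j ≤ k), F ⟨j, Nat.lt_succ_of_le (hj.trans hk.le)⟩ = 0) := by
  refine ⟨momentRay_component_eq F, fun hn k hk h j hj => ?_⟩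
  refine Subtype.ext (funext fun i => ?_)
  refine eq_zero_of_momentRay_eq_zero hn ?_
  -- The formula for index j uses only moments l ≤ j ≤ k, all of which vanish by hypothesis.
  have hzero (i' : Fin j → Fin n) : ∑ l ∈ Finset.range (j + 1),
      ((-1 : ℝ) ^ l * (j.choose l : ℝ)) • mixedDeriv l i' (genMomentRay l F) = 0 := by
    refine Finset.sum_eq_zero fun l hl => ?_
    rw [h l ((Nat.lt_succ_iff.1 (Finset.mem_range.1 hl)).trans hj), mixedDeriv,
      LineDeriv.iteratedLineDerivOp_zero, distribution_smul_zero]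
  rw [momentRay_component_eq F j (hj.trans hk.le) i]
  simp only [symmetrize, hzero, eulerOp_zero, Finset.sum_const_zero, distribution_smul_zero]
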